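/- Let $\Omega=(a,b)$ be a bounded nonempty open interval, $0<\alpha<1$, $1<p<\infty$, $0\le\theta\le1$ and $\lambda\in\{0,1\}$. Let ${}^{-}I^{\beta}f(x)=\frac1{\Gamma(\beta)}\int_a^x(x-t)^{\beta-1}f(t)\,dt$ and ${}^{+}I^{\beta}f(x)=\frac1{\Gamma(\beta)}\int_x^b(t-x)^{\beta-1}f(t)\,dt$ be the Riemann–Liouville integrals, and for $\varphi\in C_0^\infty(\Omega)$ let ${}^{\pm}D^{\alpha}\varphi=\mp\,{}^{\pm}I^{1-\alpha}\varphi'$ be its classical right ($+$) and left ($-$) derivative of order $\alpha$. A function ${}^{\pm}\mathcal D^{\alpha}u\in L^1_{loc}(\Omega)$ is the right/left weak fractional derivative of $u\in L^1(\Omega)$ if $\int_\Omega {}^{\pm}\mathcal D^{\alpha}u\,\varphi\,dx=\int_\Omega u\;{}^{\mp}D^{\alpha}\varphi\,dx$ for all $\varphi\in C_0^\infty(\Omega)$. Put $${}^{\pm}W^{\alpha,p}(\Omega)=\{u\in L^p(\Omega):{}^{\pm}\mathcal D^{\alpha}u\in L^p(\Omega)\},\qquad \|u\|_{{}^{\pm}W^{\alpha,p}}=\bigl(\|u\|_{L^p}^p+\|{}^{\pm}\mathcal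 D^{\alpha}u\|_{L^p}^p\bigr)^{1/p},$$ let ${}^{\pm}\mathring W^{\alpha,p}(\Omega)$ be the subspace of ${}^{\pm}W^{\alpha,p}(\Omega)$ on which the boundary value of ${}^{\pm}I^{1-\alpha}u$ (at $b$ for $+$, at $a$ for $-$) vanishes, and let $W^{\alpha,p}(\Omega)={}^{-}W^{\alpha,p}(\Omega)\cap{}^{+}W^{\alpha,p}(\Omega)$ with norm $\bigl(\|u\|_{{}^{-}W^{\alpha,p}}^p+\|u\|_{{}^{+}W^{\alpha,p}}^p\bigr)^{1/p}$. Let $\mathcal W^{\alpha,p}_{\theta,\lambda}$ be $W^{\alpha,p}(\Omega)$ if $0<\theta<1$; if $\theta=0$, let it be ${}^{-}\mathring W^{\alpha,p}(\Omega)$ for $\lambda=0$ and ${}^{-}W^{\alpha,p}(\Omega)$ for $\lambda=1$; if $\theta=1$, let it be ${}^{+}\mathring W^{\alpha,p}(\Omega)$ for $\lambda=0$ and ${}^{+}W^{\alpha,p}(\Omega)$ for $\lambda=1$; each with the norm just given. Let $L:\mathbb R^3\times\Omega\to\mathbb R$, $(a_1,a_2,a_3,x)\mapsto L(a_1,a_2,a_3,x)$,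 depend on $(a_1,a_2)$ only through $((1-\theta)a_1,\theta a_2)$ (that is, $L$ is independent of $a_2$ if $\theta=0$ and independent of $a_1$ if $\theta=1$). Assume that $L$ is $C^\infty$, bounded from below, and convex in $(a_1,a_2)$ for each fixed $(a_3,x)$, and that there are $C^\infty$ functions $L^1,L^2:\mathbb R^2\times\Omega\to\mathbb R$ such that $$\frac{\partial L}{\partial a_1}(a_1,a_2,a_3,x)=L^1(a_1,a_3,x),\qquad \frac{\partial L}{\partial a_2}(a_1,a_2,a_3,x)=L^2(a_2,a_3,x)$$ for all $(a_1,a_2,a_3)\in\mathbb R^3$ and $x\in\Omega$. Then the energy $$\mathcal E(v)=\int_\Omega L\bigl({}^{-}\mathcal D^{\alpha}v(x),{}^{+}\mathcal D^{\alpha}v(x),v(x),x\bigr)\,dx\in(-\infty,+\infty]$$ is weakly lower semicontinuous on $\mathcal W^{\alpha,p}_{\theta,\lambda}$: if $v_k\rightharpoonup v$ weakly in $\mathcal W^{\alpha,p}_{\theta,\lambda}$, then $\mathcal E(v)\le\liminf_{k\to\infty}\mathcal E(v_k)$. (If $\theta=0$ or $\theta=1$, the derivative on which $L$ does not depend need not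 exist and plays no role.) -/

import Mathlib

open MeasureTheory Set Filter Topology
open scoped ENNReal ContDiff

noncomputable section

namespace FracCalc

/-- The direction of a one-sided fractional operator on `(a, b)`:
`left` is the superscript `-` (base point `a`), `right` is the superscript `+` (base point `b`). -/
inductive Side where
  | left : Side
  | right : Side

/-- The opposite direction. -/
def Side.opp : Side → Side
  | .left => .right
  | .right => .left

/-- The set of those `t` in `(a, b)` that the one-sided operators see from the point `x`. -/
def Side.region (a b : ℝ) (x : ℝ) : Side → Set ℝ
  | .left => Ioo a x
  | .right => Ioo x b

/-- The sign in the one-sided derivative: `+` on the left, `-` on the right. -/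
def Side.sign : Side → ℝ
  | .left => 1
  | .right => -1

/-- The filter "`x` tends to the base point from inside `(a, b)`, outside a null set":
one-sided essential limits at the base point are limits along this filter. -/
def Side.baseFilter (a b : ℝ) : Side → Filter ℝ
  | .left => 𝓝[>] a ⊓ ae volume
  | .right => 𝓝[<] b ⊓ ae volume

/-- Left and right Riemann-Liouville fractional integrals of order `β`:
`(1 / Γ β) ∫_a^x (x - t)^(β - 1) f t dt` and `(1 / Γ β) ∫_x^b (t - x)^(β - 1) f t dt`. -/
def fracInt (a b β : ℝ) (s : Side) (f : ℝ → ℝ) (x : ℝ) : ℝ :=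
  (Real.Gamma β)⁻¹ * ∫ t in s.region a b x, |x - t| ^ (β - 1) * f t

/-- The classical left and right derivative of order `0 < α < 1` of a test function supported in
`(a, b)`: `(1 / Γ (1 - α)) ∫_a^x φ' t (x - t)^(-α) dt` and
`-(1 / Γ (1 - α)) ∫_x^b φ' t (t - x)^(-α) dt`. -/
def classicalFracDeriv (a b α : ℝ) (s : Side) (φ : ℝ → ℝ) (x : ℝ) : ℝ :=
  s.sign * fracInt a b (1 - α) s (deriv φ) x

/-- `φ` is (the zero extension of) a function in `C_0^∞((a, b))`. -/
structure IsTestFunction (a b : ℝ) (φ : ℝ → ℝ) : Prop where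
  contDiff : ContDiff ℝ ∞ φ
  hasCompactSupport : HasCompactSupport φ
  tsupport_subset : tsupport φ ⊆ Ioo a b

/-- `v` is the left (right) weak fractional derivative of order `0 < α < 1` of `u` on `(a, b)`. -/
structure IsWeakFracDeriv (a b α : ℝ) (s : Side) (u v : ℝ → ℝ) : Prop where
  locallyIntegrableOn : LocallyIntegrableOn v (Ioo a b)
  integral_eq : ∀ φ : ℝ → ℝ, IsTestFunction a b φ →
    ∫ x in Ioo a b, v x * φ x = ∫ x in Ioo a b, u x * classicalFracDeriv a b α s.opp φ x

open Classical in
/-- The left (right) weak fractional derivative of `u` (unique up to null sets); it is `0` by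
convention if `u` has none. -/
def weakFracDeriv (a b α : ℝ) (s : Side) (u : ℝ → ℝ) : ℝ → ℝ :=
  if h : ∃ v, IsWeakFracDeriv a b α s u v then h.choose else 0

/-- The space `L^p((a, b))`. -/
abbrev LpI (a b : ℝ) (p : ℝ≥0∞) : Type := Lp ℝ p (volume.restrict (Ioo a b))

/-! Facts needed to see that the spaces below are linear and that their norms are norms. -/

/-- The convolution kernel `|s| ^ r`, cut off outside `(-c, c)`. -/
def cutKernel (r c : ℝ) : ℝ → ℝ := (Ioo (-c) c).indicator (fun s => |s| ^ r)

theorem integrable_cutKernel {r : ℝ} (hr : -1 < r) (c : ℝ) : Integrable (cutKernel r c) := by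
  rw [cutKernel, integrable_indicator_iff measurableSet_Ioo]
  have h1 : IntegrableOn (fun s : ℝ => |s| ^ r) (Ioc 0 |c|) := by
    have h := (intervalIntegral.intervalIntegrable_rpow' (a := 0) (b := |c|) hr).1
    refine h.congr_fun (fun s hs => ?_) measurableSet_Ioc
    simp only [abs_of_pos hs.1]
  have h2 : IntegrableOn (fun s : ℝ => |s| ^ r) (Ico (-|c|) 0) := by
    have h := h1.comp_neg
    simpa using h
  have h3 : IntegrableOn (fun s : ℝ => |s| ^ r) {0} := integrableOn_singleton (by simp) (by simp)
  refine ((h2.union h3).union h1).mono_set ?_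
  intro s hs
  have hc : c ≤ |c| := le_abs_self c
  rcases lt_trichotomy s 0 with h | h | h
  · exact Or.inl (Or.inl ⟨by linarith [hs.1], h⟩)
  · exact Or.inl (Or.inr h)
  · exact Or.inr ⟨h, by linarith [hs.2]⟩

theorem cutKernel_nonneg (r c x : ℝ) : 0 ≤ cutKernel r c x :=
  indicator_nonneg (fun _ _ => by positivity) x

theorem measurableSet_region (a b x : ℝ) (s : Side) : MeasurableSet (s.region a b x) := by
  cases s <;> exact measurableSet_Ioo

theorem region_subset {a b x : ℝ} (hx : x ∈ Ioo a b) (s : Side) :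
    s.region a b x ⊆ Ioo a b := by
  cases s
  · exact fun t ht => ⟨ht.1, ht.2.trans hx.2⟩
  · exact fun t ht => ⟨hx.1.trans ht.1, ht.2⟩

theorem cutKernel_eq {a b x t : ℝ} (hx : x ∈ Ioo a b) (ht : t ∈ Ioo a b) (r : ℝ) :
    cutKernel r (b - a) (x - t) = |x - t| ^ r := by
  have h : x - t ∈ Ioo (-(b - a)) (b - a) := by
    constructor <;> linarith [hx.1, hx.2, ht.1, ht.2]
  exact indicator_of_mem h _

theorem exists_bound_classicalFracDeriv (a b : ℝ) {α : ℝ} (hα : α ∈ Ioo (0 : ℝ) 1) (s : Side)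
    {φ : ℝ → ℝ} (hφ : IsTestFunction a b φ) :
    ∃ C, ∀ x ∈ Ioo a b, ‖classicalFracDeriv a b α s φ x‖ ≤ C := by
  obtain ⟨M, hM⟩ := (hφ.hasCompactSupport.deriv).exists_bound_of_continuous
    (hφ.contDiff.continuous_deriv (by simp))
  have hK := integrable_cutKernel (r := 1 - α - 1) (by linarith [hα.2]) (b - a)
  refine ⟨|s.sign| * (|(Real.Gamma (1 - α))⁻¹| *
    ∫ t, cutKernel (1 - α - 1) (b - a) t * M), fun x hx => ?_⟩
  rw [classicalFracDeriv, fracInt, norm_mul, norm_mul, Real.norm_eq_abs, Real.norm_eq_abs]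
  gcongr
  have hKx : Integrable (fun t => cutKernel (1 - α - 1) (b - a) (x - t) * M) :=
    (hK.comp_sub_left x).mul_const M
  have hM0 : 0 ≤ M := (norm_nonneg _).trans (hM 0)
  calc ‖∫ t in s.region a b x, |x - t| ^ (1 - α - 1) * deriv φ t‖
      ≤ ∫ t in s.region a b x, cutKernel (1 - α - 1) (b - a) (x - t) * M := by
        refine norm_integral_le_of_norm_le hKx.integrableOn ?_
        refine (ae_restrict_iff' (measurableSet_region a b x s)).2 (ae_of_all _ fun t ht => ?_)
        rw [cutKernel_eq hx (region_subset hx s ht), norm_mul,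
          Real.norm_of_nonneg (by positivity : 0 ≤ |x - t| ^ (1 - α - 1))]
        exact mul_le_mul_of_nonneg_left (hM t) (by positivity)
    _ ≤ ∫ t, cutKernel (1 - α - 1) (b - a) (x - t) * M :=
        setIntegral_le_integral hKx
          (ae_of_all _ fun t => mul_nonneg (cutKernel_nonneg _ _ _) hM0)
    _ = ∫ t, cutKernel (1 - α - 1) (b - a) t * M :=
        integral_sub_left_eq_self (fun t => cutKernel (1 - α - 1) (b - a) t * M) volume x

theorem measurable_fracInt (a b β : ℝ) (s : Side) {f : ℝ → ℝ} (hf : Measurable f) :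
    Measurable (fracInt a b β s f) := by
  have hS : MeasurableSet {z : ℝ × ℝ | z.2 ∈ s.region a b z.1} := by
    cases s
    · exact (measurableSet_lt measurable_const measurable_snd).inter
        (measurableSet_lt measurable_snd measurable_fst)
    · exact (measurableSet_lt measurable_fst measurable_snd).inter
        (measurableSet_lt measurable_snd measurable_const)
  have hF : Measurable ({z : ℝ × ℝ | z.2 ∈ s.region a b z.1}.indicator
      (fun z => |z.1 - z.2| ^ (β - 1) * f z.2)) := by
    refine Measurable.indicator ?_ hS
    exact ((measurable_fst.sub measurable_snd).norm.pow_const _).mul (hf.comp measurable_snd)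
  have h := hF.stronglyMeasurable.integral_prod_right' (ν := volume)
  convert h.measurable.const_mul (Real.Gamma β)⁻¹ using 1
  funext x
  rw [fracInt, ← integral_indicator (measurableSet_region a b x s)]
  rfl

theorem integrable_mul_classicalFracDeriv {a b α : ℝ} (hα : α ∈ Ioo (0 : ℝ) 1) (s : Side)
    {φ : ℝ → ℝ} (hφ : IsTestFunction a b φ) {u : ℝ → ℝ} (hu : IntegrableOn u (Ioo a b)) :
    IntegrableOn (fun x => u x * classicalFracDeriv a b α s φ x) (Ioo a b) := by
  obtain ⟨C, hC⟩ := exists_bound_classicalFracDeriv a b hα s hφ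
  refine Integrable.mul_bdd (c := C) hu ?_
    ((ae_restrict_iff' measurableSet_Ioo).2 (ae_of_all _ hC))
  exact ((measurable_fracInt a b (1 - α) s (measurable_deriv φ)).const_mul
    s.sign).aestronglyMeasurable

theorem integrable_mul_testFunction {a b : ℝ} {φ : ℝ → ℝ} (hφ : IsTestFunction a b φ)
    {v : ℝ → ℝ} (hv : LocallyIntegrableOn v (Ioo a b)) :
    IntegrableOn (fun x => v x * φ x) (Ioo a b) := by
  have h := (hv.integrableOn_compact_subset hφ.tsupport_subset
    hφ.hasCompactSupport).mul_continuousOn hφ.contDiff.continuous.continuousOn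
    hφ.hasCompactSupport
  refine IntegrableOn.of_forall_sdiff_eq_zero h measurableSet_Ioo fun x hx => ?_
  rw [image_eq_zero_of_notMem_tsupport hx.2, mul_zero]

theorem IsWeakFracDeriv.congr_left {a b α : ℝ} {s : Side} {u u' v : ℝ → ℝ}
    (h : IsWeakFracDeriv a b α s u v) (hu : u =ᵐ[volume.restrict (Ioo a b)] u') :
    IsWeakFracDeriv a b α s u' v := by
  refine ⟨h.1, fun φ hφ => ?_⟩
  rw [h.2 φ hφ]
  refine integral_congr_ae ?_
  filter_upwards [hu] with x hx
  rw [hx]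

theorem IsWeakFracDeriv.add {a b α : ℝ} (hα : α ∈ Ioo (0 : ℝ) 1) {s : Side}
    {u₁ u₂ v₁ v₂ : ℝ → ℝ} (hu₁ : IntegrableOn u₁ (Ioo a b)) (hu₂ : IntegrableOn u₂ (Ioo a b))
    (h₁ : IsWeakFracDeriv a b α s u₁ v₁) (h₂ : IsWeakFracDeriv a b α s u₂ v₂) :
    IsWeakFracDeriv a b α s (u₁ + u₂) (v₁ + v₂) := by
  refine ⟨h₁.1.add h₂.1, fun φ hφ => ?_⟩
  simp only [Pi.add_apply, add_mul]
  rw [integral_add (integrable_mul_testFunction hφ h₁.1) (integrable_mul_testFunction hφ h₂.1),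
    integral_add (integrable_mul_classicalFracDeriv hα _ hφ hu₁)
      (integrable_mul_classicalFracDeriv hα _ hφ hu₂), h₁.2 φ hφ, h₂.2 φ hφ]

theorem IsWeakFracDeriv.smul {a b α : ℝ} {s : Side} {u v : ℝ → ℝ} (c : ℝ)
    (h : IsWeakFracDeriv a b α s u v) : IsWeakFracDeriv a b α s (c • u) (c • v) := by
  refine ⟨h.1.smul c, fun φ hφ => ?_⟩
  simp only [Pi.smul_apply, smul_eq_mul, mul_assoc]
  rw [integral_const_mul, integral_const_mul, h.2 φ hφ]

theorem IsWeakFracDeriv.zero (a b α : ℝ) (s : Side) : IsWeakFracDeriv a b α s 0 0 :=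
  ⟨locallyIntegrableOn_zero, fun φ _ => by simp⟩

theorem IsWeakFracDeriv.ae_eq {a b α : ℝ} {s : Side} {u v₁ v₂ : ℝ → ℝ}
    (h₁ : IsWeakFracDeriv a b α s u v₁) (h₂ : IsWeakFracDeriv a b α s u v₂) :
    v₁ =ᵐ[volume.restrict (Ioo a b)] v₂ := by
  have h := IsOpen.ae_eq_zero_of_integral_contDiff_smul_eq_zero (isOpen_Ioo (a := a) (b := b))
    (h₁.1.sub h₂.1) (fun φ h1 h2 h3 => ?_)
  · rw [Filter.EventuallyEq, ae_restrict_iff' measurableSet_Ioo]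
    filter_upwards [h] with x hx hxI
    exact sub_eq_zero.1 (hx hxI)
  · have hφ : IsTestFunction a b φ := ⟨h1, h2, h3⟩
    rw [← setIntegral_eq_integral_of_forall_compl_eq_zero (s := Ioo a b) (fun x hx => by
      rw [image_eq_zero_of_notMem_tsupport (fun h => hx (h3 h)), zero_smul])]
    have e : (fun x => φ x • (v₁ - v₂) x) = fun x => v₁ x * φ x - v₂ x * φ x := by
      funext x; simp only [smul_eq_mul, Pi.sub_apply]; ring
    rw [e, integral_sub (integrable_mul_testFunction hφ h₁.1)
      (integrable_mul_testFunction hφ h₂.1), h₁.2 φ hφ, h₂.2 φ hφ, sub_self]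

theorem IsWeakFracDeriv.weakFracDeriv_ae_eq {a b α : ℝ} {s : Side} {u v : ℝ → ℝ}
    (h : IsWeakFracDeriv a b α s u v) :
    weakFracDeriv a b α s u =ᵐ[volume.restrict (Ioo a b)] v := by
  have hex : ∃ v, IsWeakFracDeriv a b α s u v := ⟨v, h⟩
  rw [weakFracDeriv, dif_pos hex]
  exact hex.choose_spec.ae_eq h

theorem integrableOn_coe {a b : ℝ} {p : ℝ≥0∞} [Fact (1 ≤ p)] (u : LpI a b p) :
    IntegrableOn u (Ioo a b) :=
  (Lp.memLp u).integrable Fact.out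

theorem fracInt_congr {a b β x : ℝ} (hx : x ∈ Ioo a b) (s : Side) {f g : ℝ → ℝ}
    (h : f =ᵐ[volume.restrict (Ioo a b)] g) : fracInt a b β s f x = fracInt a b β s g x := by
  rw [fracInt, fracInt]
  congr 1
  refine integral_congr_ae ?_
  filter_upwards [ae_restrict_of_ae_restrict_of_subset (region_subset hx s) h] with t ht
  rw [ht]

theorem ae_fracInt_add {a b α : ℝ} (hα : α ∈ Ioo (0 : ℝ) 1) (s : Side) {f g : ℝ → ℝ}
    (hf : IntegrableOn f (Ioo a b)) (hg : IntegrableOn g (Ioo a b)) :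
    ∀ᵐ x, x ∈ Ioo a b → fracInt a b (1 - α) s (f + g) x =
      fracInt a b (1 - α) s f x + fracInt a b (1 - α) s g x := by
  have key : ∀ f : ℝ → ℝ, IntegrableOn f (Ioo a b) → ∀ᵐ x, x ∈ Ioo a b →
      IntegrableOn (fun t => |x - t| ^ (1 - α - 1) * f t) (s.region a b x) := by
    intro f hf
    have hK := integrable_cutKernel (r := 1 - α - 1) (by linarith [hα.2]) (b - a)
    have hf' := (integrable_indicator_iff measurableSet_Ioo).2 hf
    filter_upwards [hf'.ae_convolution_exists (ContinuousLinearMap.mul ℝ ℝ) hK] with x hx hxI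
    have h : Integrable (fun t => (Ioo a b).indicator f t *
      cutKernel (1 - α - 1) (b - a) (x - t)) := hx
    refine (h.integrableOn (s := s.region a b x)).congr_fun (fun t ht => ?_)
      (measurableSet_region a b x s)
    have ht' := region_subset hxI s ht
    simp only [cutKernel_eq hxI ht', indicator_of_mem ht', mul_comm]
  filter_upwards [key f hf, key g hg] with x h1 h2 hx
  simp only [fracInt, Pi.add_apply, mul_add]
  rw [integral_add (h1 hx) (h2 hx), mul_add]

theorem eventually_baseFilter {a b : ℝ} (hab : a < b) (s : Side) {P : ℝ → Prop}
    (h : ∀ᵐ x, x ∈ Ioo a b → P x) : ∀ᶠ x in s.baseFilter a b, P x := by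
  cases s
  · have h1 : ∀ᶠ x in Side.left.baseFilter a b, x ∈ Ioo a b :=
      (Ioo_mem_nhdsGT hab : Ioo a b ∈ 𝓝[>] a) |> fun h => mem_inf_of_left h
    have h2 : ∀ᶠ x in Side.left.baseFilter a b, x ∈ Ioo a b → P x := mem_inf_of_right h
    filter_upwards [h1, h2] with x hx1 hx2 using hx2 hx1
  · have h1 : ∀ᶠ x in Side.right.baseFilter a b, x ∈ Ioo a b :=
      (Ioo_mem_nhdsLT hab : Ioo a b ∈ 𝓝[<] b) |> fun h => mem_inf_of_left h
    have h2 : ∀ᶠ x in Side.right.baseFilter a b, x ∈ Ioo a b → P x := mem_inf_of_right h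
    filter_upwards [h1, h2] with x hx1 hx2 using hx2 hx1

/-! The spaces. -/

/-- The left (right) fractional Sobolev space: the functions in `L^p((a, b))` with a left (right)
weak fractional derivative of order `α` in `L^p((a, b))`. -/
def oneSidedSobolev (a b : ℝ) {α : ℝ} (hα : α ∈ Ioo (0 : ℝ) 1) (p : ℝ≥0∞) [Fact (1 ≤ p)]
    (s : Side) : Submodule ℝ (LpI a b p) where
  carrier := {u | ∃ v, IsWeakFracDeriv a b α s u v ∧ MemLp v p (volume.restrict (Ioo a b))}
  add_mem' := by
    rintro u₁ u₂ ⟨v₁, h₁, m₁⟩ ⟨v₂, h₂, m₂⟩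
    exact ⟨v₁ + v₂, (h₁.add hα (integrableOn_coe u₁) (integrableOn_coe u₂) h₂).congr_left
      (Lp.coeFn_add u₁ u₂).symm, m₁.add m₂⟩
  zero_mem' := ⟨0, (IsWeakFracDeriv.zero a b α s).congr_left (Lp.coeFn_zero _ _ _).symm,
    MemLp.zero⟩
  smul_mem' := by
    rintro c u ⟨v, h, m⟩
    exact ⟨c • v, (h.smul c).congr_left (Lp.coeFn_smul c u).symm, m.const_smul c⟩

/-- The subspace of the left (right) fractional Sobolev space in which the constant
`c^{1-α}`, a multiple of the boundary value of the left (right) fractional integral of order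
`1 - α` at the base point `a` (`b`), vanishes. -/
def oneSidedSobolevCirc {a b : ℝ} (hab : a < b) {α : ℝ} (hα : α ∈ Ioo (0 : ℝ) 1) (p : ℝ≥0∞)
    [Fact (1 ≤ p)] (s : Side) : Submodule ℝ (LpI a b p) where
  carrier := {u | u ∈ oneSidedSobolev a b hα p s ∧
    Tendsto (fracInt a b (1 - α) s u) (s.baseFilter a b) (𝓝 0)}
  add_mem' := by
    rintro u₁ u₂ ⟨h₁, t₁⟩ ⟨h₂, t₂⟩
    refine ⟨add_mem h₁ h₂, ?_⟩
    have t := t₁.add t₂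
    rw [add_zero] at t
    refine t.congr' (eventually_baseFilter hab s ?_)
    filter_upwards [ae_fracInt_add hα s (integrableOn_coe u₁) (integrableOn_coe u₂)] with x hx hxI
    rw [fracInt_congr hxI s (Lp.coeFn_add u₁ u₂), hx hxI]
  zero_mem' := by
    refine ⟨zero_mem _, tendsto_const_nhds.congr' (eventually_baseFilter hab s
      (ae_of_all _ fun x hx => ?_))⟩
    rw [fracInt_congr hx s (Lp.coeFn_zero ℝ p _)]
    simp [fracInt]
  smul_mem' := by
    rintro c u ⟨h, t⟩
    refine ⟨Submodule.smul_mem _ c h, ?_⟩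
    have t' := t.const_mul c
    rw [mul_zero] at t'
    refine t'.congr' (eventually_baseFilter hab s (ae_of_all _ fun x hx => ?_))
    rw [fracInt_congr hx s (Lp.coeFn_smul c u)]
    simp only [fracInt, Pi.smul_apply, smul_eq_mul, mul_left_comm _ c, integral_const_mul]

open Classical in
/-- The underlying linear space of the two-parameter family of fractional Sobolev spaces. -/
def fracSubmodule {a b : ℝ} (hab : a < b) {α : ℝ} (hα : α ∈ Ioo (0 : ℝ) 1) (p : ℝ≥0∞)
    [Fact (1 ≤ p)] (θ lam : ℝ) : Submodule ℝ (LpI a b p) :=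
  if θ = 0 then
    if lam = 0 then oneSidedSobolevCirc hab hα p .left else oneSidedSobolev a b hα p .left
  else if θ = 1 then
    if lam = 0 then oneSidedSobolevCirc hab hα p .right else oneSidedSobolev a b hα p .right
  else
    oneSidedSobolev a b hα p .left ⊓ oneSidedSobolev a b hα p .right

/-- The two-parameter family of fractional Sobolev spaces, as a type that does not inherit the
norm of `L^p`. -/
def FracSpace {a b : ℝ} (hab : a < b) {α : ℝ} (hα : α ∈ Ioo (0 : ℝ) 1) (p : ℝ≥0∞)
    [Fact (1 ≤ p)] (θ lam : ℝ) : Type :=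
  fracSubmodule hab hα p θ lam

open Classical in
/-- The weak derivative as an element of `L^p` (`0` by convention if it is not one). -/
def weakFracDerivLp {a b : ℝ} (α : ℝ) {p : ℝ≥0∞} (s : Side) (u : LpI a b p) : LpI a b p :=
  if h : MemLp (weakFracDeriv a b α s u) p (volume.restrict (Ioo a b)) then h.toLp else 0

/-- The pair of `u` and its left (right) weak derivative in the `ℓ^p` product `L^p × L^p`; its norm
is `(‖u‖^p + ‖D u‖^p)^(1/p)`, the norm of the one-sided space. -/
def oneSidedGraph {a b : ℝ} (α : ℝ) {p : ℝ≥0∞} (s : Side) (u : LpI a b p) :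
    WithLp p (LpI a b p × LpI a b p) :=
  WithLp.toLp p (u, weakFracDerivLp α s u)

/-- The norm `(‖u‖^p + ‖D u‖^p)^(1/p)` of the left (right) fractional Sobolev space. -/
def oneSidedNorm {a b : ℝ} (α : ℝ) {p : ℝ≥0∞} [Fact (1 ≤ p)] (s : Side) (u : LpI a b p) : ℝ :=
  ‖oneSidedGraph α s u‖

/-- The `ℓ^p` combination of the left and right norms, the norm of the symmetric space. -/
def symmNorm {a b : ℝ} (α : ℝ) {p : ℝ≥0∞} [Fact (1 ≤ p)] (u : LpI a b p) : ℝ :=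
  ‖WithLp.toLp p (oneSidedGraph α .left u, oneSidedGraph α .right u)‖

theorem oneSidedNorm_eq {a b : ℝ} (α : ℝ) {p : ℝ≥0∞} [Fact (1 ≤ p)] (hp : p ≠ ⊤) (s : Side)
    (u : LpI a b p) : oneSidedNorm α s u =
      (‖u‖ ^ p.toReal + ‖weakFracDerivLp α s u‖ ^ p.toReal) ^ (1 / p.toReal) :=
  WithLp.prod_norm_eq_add (ENNReal.toReal_pos (zero_lt_one.trans_le Fact.out).ne' hp) _

theorem symmNorm_eq {a b : ℝ} (α : ℝ) {p : ℝ≥0∞} [Fact (1 ≤ p)] (hp : p ≠ ⊤)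
    (u : LpI a b p) : symmNorm α u =
      (oneSidedNorm α .left u ^ p.toReal + oneSidedNorm α .right u ^ p.toReal) ^ (1 / p.toReal) :=
  WithLp.prod_norm_eq_add (ENNReal.toReal_pos (zero_lt_one.trans_le Fact.out).ne' hp) _

theorem weakFracDerivLp_ae_eq {a b α : ℝ} {p : ℝ≥0∞} {s : Side} {u : LpI a b p} {v : ℝ → ℝ}
    (h : IsWeakFracDeriv a b α s u v) (m : MemLp v p (volume.restrict (Ioo a b))) :
    weakFracDerivLp α s u = m.toLp := by
  have m' := m.ae_eq h.weakFracDeriv_ae_eq.symm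
  rw [weakFracDerivLp, dif_pos m']
  exact (MemLp.toLp_eq_toLp_iff _ _).2 h.weakFracDeriv_ae_eq

theorem oneSidedGraph_add {a b α : ℝ} (hα : α ∈ Ioo (0 : ℝ) 1) {p : ℝ≥0∞} [Fact (1 ≤ p)]
    {s : Side} {u₁ u₂ : LpI a b p} (h₁ : u₁ ∈ oneSidedSobolev a b hα p s)
    (h₂ : u₂ ∈ oneSidedSobolev a b hα p s) :
    oneSidedGraph α s (u₁ + u₂) = oneSidedGraph α s u₁ + oneSidedGraph α s u₂ := by
  obtain ⟨v₁, h₁, m₁⟩ := h₁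
  obtain ⟨v₂, h₂, m₂⟩ := h₂
  have h := (h₁.add hα (integrableOn_coe u₁) (integrableOn_coe u₂) h₂).congr_left
      (Lp.coeFn_add u₁ u₂).symm
  rw [oneSidedGraph, oneSidedGraph, oneSidedGraph, weakFracDerivLp_ae_eq h₁ m₁,
    weakFracDerivLp_ae_eq h₂ m₂, weakFracDerivLp_ae_eq h (m₁.add m₂)]
  rfl

theorem oneSidedGraph_smul {a b α : ℝ} (hα : α ∈ Ioo (0 : ℝ) 1) {p : ℝ≥0∞} [Fact (1 ≤ p)]
    {s : Side} (c : ℝ) {u : LpI a b p} (h : u ∈ oneSidedSobolev a b hα p s) :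
    oneSidedGraph α s (c • u) = c • oneSidedGraph α s u := by
  obtain ⟨v, h, m⟩ := h
  rw [oneSidedGraph, oneSidedGraph, weakFracDerivLp_ae_eq h m,
    weakFracDerivLp_ae_eq ((h.smul c).congr_left (Lp.coeFn_smul c u).symm) (m.const_smul c)]
  rfl

theorem oneSidedNorm_core {a b α : ℝ} (hα : α ∈ Ioo (0 : ℝ) 1) {p : ℝ≥0∞} [Fact (1 ≤ p)]
    (s : Side) :
    (∀ u : LpI a b p, 0 ≤ oneSidedNorm α s u) ∧
    (∀ (c : ℝ) (u : LpI a b p), u ∈ oneSidedSobolev a b hα p s →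
      oneSidedNorm α s (c • u) = ‖c‖ * oneSidedNorm α s u) ∧
    (∀ u v : LpI a b p, u ∈ oneSidedSobolev a b hα p s → v ∈ oneSidedSobolev a b hα p s →
      oneSidedNorm α s (u + v) ≤ oneSidedNorm α s u + oneSidedNorm α s v) ∧
    (∀ u : LpI a b p, oneSidedNorm α s u = 0 → u = 0) := by
  refine ⟨fun u => norm_nonneg _, fun c u h => ?_, fun u v hu hv => ?_, fun u h => ?_⟩
  · rw [oneSidedNorm, oneSidedGraph_smul hα c h, norm_smul]; rfl
  · rw [oneSidedNorm, oneSidedGraph_add hα hu hv]; exact norm_add_le _ _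
  · have h' := congrArg (fun z => (WithLp.ofLp z).1) (norm_eq_zero.1 h)
    exact h'

theorem symmNorm_core {a b α : ℝ} (hα : α ∈ Ioo (0 : ℝ) 1) {p : ℝ≥0∞} [Fact (1 ≤ p)] :
    (∀ u : LpI a b p, 0 ≤ symmNorm α u) ∧
    (∀ (c : ℝ) (u : LpI a b p),
      u ∈ oneSidedSobolev a b hα p .left ⊓ oneSidedSobolev a b hα p .right →
      symmNorm α (c • u) = ‖c‖ * symmNorm α u) ∧
    (∀ u v : LpI a b p,
      u ∈ oneSidedSobolev a b hα p .left ⊓ oneSidedSobolev a b hα p .right →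
      v ∈ oneSidedSobolev a b hα p .left ⊓ oneSidedSobolev a b hα p .right →
      symmNorm α (u + v) ≤ symmNorm α u + symmNorm α v) ∧
    (∀ u : LpI a b p, symmNorm α u = 0 → u = 0) := by
  refine ⟨fun u => norm_nonneg _, fun c u h => ?_, fun u v hu hv => ?_, fun u h => ?_⟩
  · rw [symmNorm, oneSidedGraph_smul hα c h.1, oneSidedGraph_smul hα c h.2]
    exact norm_smul c (WithLp.toLp p (oneSidedGraph α .left u, oneSidedGraph α .right u))
  · rw [symmNorm, oneSidedGraph_add hα hu.1 hv.1, oneSidedGraph_add hα hu.2 hv.2]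
    exact norm_add_le (WithLp.toLp p (oneSidedGraph α .left u, oneSidedGraph α .right u))
      (WithLp.toLp p (oneSidedGraph α .left v, oneSidedGraph α .right v))
  · have h' := congrArg (fun z => (WithLp.ofLp (WithLp.ofLp z).1).1) (norm_eq_zero.1 h)
    exact h'

namespace FracSpace

variable {a b : ℝ} {hab : a < b} {α : ℝ} {hα : α ∈ Ioo (0 : ℝ) 1} {p : ℝ≥0∞} [Fact (1 ≤ p)]
  {θ lam : ℝ}

instance : AddCommGroup (FracSpace hab hα p θ lam) :=
  inferInstanceAs (AddCommGroup (fracSubmodule hab hα p θ lam))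

instance : Module ℝ (FracSpace hab hα p θ lam) :=
  inferInstanceAs (Module ℝ (fracSubmodule hab hα p θ lam))

/-- The underlying element of `L^p((a, b))`. -/
def toLpI (u : FracSpace hab hα p θ lam) : LpI a b p := u.1

open Classical in
/-- The norm of the two-parameter family: the left, right or symmetric norm according as `θ = 0`,
`θ = 1` or `0 < θ < 1`. -/
instance : Norm (FracSpace hab hα p θ lam) where
  norm u :=
    if θ = 0 then oneSidedNorm α .left u.toLpI
    else if θ = 1 then oneSidedNorm α .right u.toLpI
    else symmNorm α u.toLpI

theorem circ_le (s : Side) : oneSidedSobolevCirc hab hα p s ≤ oneSidedSobolev a b hα p s :=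
  fun _ h => h.1

theorem mem_left (u : FracSpace hab hα p θ lam) (h : θ ≠ 1) :
    u.toLpI ∈ oneSidedSobolev a b hα p .left := by
  have hu : u.toLpI ∈ fracSubmodule hab hα p θ lam := u.2
  unfold fracSubmodule at hu
  split_ifs at hu with h1 h2
  · exact circ_le _ hu
  · exact hu
  · exact hu.1

theorem mem_right (u : FracSpace hab hα p θ lam) (h : θ ≠ 0) :
    u.toLpI ∈ oneSidedSobolev a b hα p .right := by
  have hu : u.toLpI ∈ fracSubmodule hab hα p θ lam := u.2
  unfold fracSubmodule at hu
  rw [if_neg h] at hu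
  split_ifs at hu with h1 h2
  · exact circ_le _ hu
  · exact hu
  · exact hu.2

theorem normCore : NormedSpace.Core ℝ (FracSpace hab hα p θ lam) := by
  by_cases h0 : θ = 0
  · have hn : ∀ u : FracSpace hab hα p θ lam, ‖u‖ = oneSidedNorm α .left u.toLpI :=
      fun u => if_pos h0
    have hm := fun u : FracSpace hab hα p θ lam => u.mem_left (by simp [h0])
    obtain ⟨k1, k2, k3, k4⟩ := oneSidedNorm_core (a := a) (b := b) hα (p := p) .left
    refine ⟨⟨fun u => ?_, fun c u => ?_, fun u v => ?_⟩, fun u => ⟨fun h => ?_, ?_⟩⟩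
    · rw [hn]; exact k1 _
    · rw [hn, hn]; exact k2 c _ (hm u)
    · rw [hn, hn, hn]; exact k3 _ _ (hm u) (hm v)
    · rw [hn] at h; exact Subtype.ext (k4 _ h)
    · rintro rfl
      have := k2 0 _ (hm (0 : FracSpace hab hα p θ lam))
      rw [zero_smul, norm_zero, zero_mul] at this
      rw [hn]; exact this
  by_cases h1 : θ = 1
  · have hn : ∀ u : FracSpace hab hα p θ lam, ‖u‖ = oneSidedNorm α .right u.toLpI :=
      fun u => (if_neg h0).trans (if_pos h1)
    have hm := fun u : FracSpace hab hα p θ lam => u.mem_right h0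
    obtain ⟨k1, k2, k3, k4⟩ := oneSidedNorm_core (a := a) (b := b) hα (p := p) .right
    refine ⟨⟨fun u => ?_, fun c u => ?_, fun u v => ?_⟩, fun u => ⟨fun h => ?_, ?_⟩⟩
    · rw [hn]; exact k1 _
    · rw [hn, hn]; exact k2 c _ (hm u)
    · rw [hn, hn, hn]; exact k3 _ _ (hm u) (hm v)
    · rw [hn] at h; exact Subtype.ext (k4 _ h)
    · rintro rfl
      have := k2 0 _ (hm (0 : FracSpace hab hα p θ lam))
      rw [zero_smul, norm_zero, zero_mul] at this
      rw [hn]; exact this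
  · have hn : ∀ u : FracSpace hab hα p θ lam, ‖u‖ = symmNorm α u.toLpI :=
      fun u => (if_neg h0).trans (if_neg h1)
    have hm : ∀ u : FracSpace hab hα p θ lam, u.toLpI ∈
        oneSidedSobolev a b hα p .left ⊓ oneSidedSobolev a b hα p .right :=
      fun u => ⟨u.mem_left h1, u.mem_right h0⟩
    obtain ⟨k1, k2, k3, k4⟩ := symmNorm_core (a := a) (b := b) hα (p := p)
    refine ⟨⟨fun u => ?_, fun c u => ?_, fun u v => ?_⟩, fun u => ⟨fun h => ?_, ?_⟩⟩
    · rw [hn]; exact k1 _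
    · rw [hn, hn]; exact k2 c _ (hm u)
    · rw [hn, hn, hn]; exact k3 _ _ (hm u) (hm v)
    · rw [hn] at h; exact Subtype.ext (k4 _ h)
    · rintro rfl
      have := k2 0 _ (hm (0 : FracSpace hab hα p θ lam))
      rw [zero_smul, norm_zero, zero_mul] at this
      rw [hn]; exact this

instance : NormedAddCommGroup (FracSpace hab hα p θ lam) := NormedAddCommGroup.ofCore normCore

instance : NormedSpace ℝ (FracSpace hab hα p θ lam) := NormedSpace.ofCore normCore

end FracSpace

/-! The energy. -/

/-- The integral over `(a, b)`, with values in `[-∞, ∞]`, of a function whose negative part has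
finite integral. -/
def extIntegral (a b : ℝ) (f : ℝ → ℝ) : EReal :=
  ((∫⁻ x in Ioo a b, ENNReal.ofReal (f x) : ℝ≥0∞) : EReal) -
    ((∫⁻ x in Ioo a b, ENNReal.ofReal (-f x) : ℝ≥0∞) : EReal)

/-- The energy `∫_a^b L (D⁻ v x) (D⁺ v x) (v x) x dx`. -/
def energy {a b : ℝ} (α : ℝ) {p : ℝ≥0∞} (L : ℝ → ℝ → ℝ → ℝ → ℝ) (v : LpI a b p) : EReal :=
  extIntegral a b fun x =>
    L (weakFracDeriv a b α .left v x) (weakFracDeriv a b α .right v x) (v x) x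

/-- A functional on a normed space is (sequentially) weakly lower semicontinuous if
`F v ≤ liminf F (v k)` whenever `v k` converges weakly to `v`. -/
def WeaklyLSC {X : Type*} [NormedAddCommGroup X] [NormedSpace ℝ X] (F : X → EReal) : Prop :=
  ∀ (v : ℕ → X) (w : X),
    Tendsto (fun k => toWeakSpace ℝ X (v k)) atTop (𝓝 (toWeakSpace ℝ X w)) →
    F w ≤ liminf (fun k => F (v k)) atTop

end FracCalc

end

noncomputable section

namespace FracCalc

/-! Weak convergence in the fractional space bounds the sequence and gives convergence against
bounded functions both for v_k and for each derivative that L sees. Two things remain: v_k itself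
must converge strongly, because L is not convex in its third argument, and convexity in (a₁, a₂)
must absorb the merely weak convergence of the derivatives.

Strong convergence. If u has weak derivative g, then u(x) = c|x - e|^(α-1) + κ ∫ |x - t|^(α-1) g(t)
dt, with e the base point and t on the visible side of x (`IsWeakFracDeriv.exists_ae_eq`). Indeed,
transposing the fractional integral in the definition shows that the integral of order 1 - α of u
differs from a primitive of g by a function orthogonal to every φ', that is, by a constant; the
semigroup law, a Beta integral, then recovers u. The integral term turns weak L¹ convergence into
strong convergence (`tendsto_integral_abs_sideInt_sub`), because its kernel is a bounded kernel up
to a part of small mass. The coefficient c is determined by ∫ u and the integral term, so it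
converges too.

Lower semicontinuity. Along a subsequence v_k converges almost everywhere. The tangent plane of L(·,
·, v_k, x) at the derivatives of the limit lies below the graph; its constant term and slopes depend
on k only through v_k. By Egorov's theorem they converge uniformly, to bounded limits, on sets that
eventually contain almost every point. There the slope terms integrate to zero in the limit
(`tendsto_setIntegral_mul_sub`), and Fatou's lemma recovers all of Ω
(`lintegral_le_of_forall_affine_le`). The lower bound on L allows a shift to a nonnegative
integrand, which may be restricted to subsets. -/

/-! ### One-sided integrals as integral operators on a fixed interval -/

/-- The kernel `|x - t| ^ r` on the pairs for which `t` lies on the side of `x` that the one-sided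
operators see, extended by zero. -/
def sideKernel (s : Side) (r x t : ℝ) : ℝ :=
  match s with
  | .left => (Iio x).indicator (fun t => |x - t| ^ r) t
  | .right => (Ioi x).indicator (fun t => |x - t| ^ r) t

/-- The one-sided integral `∫ |x - t| ^ (β - 1) f t dt` over `(a, b)`, without the factor
`1 / Γ β`. -/
def sideInt (a b : ℝ) (s : Side) (β : ℝ) (f : ℝ → ℝ) (x : ℝ) : ℝ :=
  ∫ t in Ioo a b, sideKernel s (β - 1) x t * f t

theorem Side.opp_opp (s : Side) : s.opp.opp = s := by cases s <;> rfl

theorem Side.sign_opp (s : Side) : s.opp.sign = -s.sign := by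
  cases s <;> simp [Side.opp, Side.sign]

theorem Side.sign_mul_self (s : Side) : s.sign * s.sign = 1 := by
  cases s <;> simp [Side.sign]

/-- The source of all integration by parts below: the operator on the opposite side is the
transpose. -/
theorem sideKernel_opp (s : Side) (r x t : ℝ) : sideKernel s.opp r x t = sideKernel s r t x := by
  cases s <;> simp [sideKernel, Side.opp, indicator_apply, abs_sub_comm]

theorem sideKernel_nonneg (s : Side) (r x t : ℝ) : 0 ≤ sideKernel s r x t := by
  have h : 0 ≤ |x - t| ^ r := by positivity
  cases s <;> simp only [sideKernel, indicator_apply] <;> split_ifs <;> simp [h]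

theorem sideKernel_le (s : Side) (r x t : ℝ) : sideKernel s r x t ≤ |x - t| ^ r := by
  have h : 0 ≤ |x - t| ^ r := by positivity
  cases s <;> simp only [sideKernel, indicator_apply] <;> split_ifs <;> simp [h]

/-- A single translation-invariant majorant for both sides; the integrability and mass bounds are
inherited from it. -/
theorem sideKernel_le_cutKernel {a b x t : ℝ} (hx : x ∈ Ioo a b) (ht : t ∈ Ioo a b) (s : Side)
    (r : ℝ) : sideKernel s r x t ≤ cutKernel r (b - a) (x - t) :=
  (sideKernel_le s r x t).trans_eq (cutKernel_eq hx ht r).symm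

theorem measurable_sideKernel (s : Side) (r : ℝ) :
    Measurable (fun z : ℝ × ℝ => sideKernel s r z.1 z.2) := by
  have h : Measurable (fun z : ℝ × ℝ => |z.1 - z.2| ^ r) :=
    (measurable_fst.sub measurable_snd).norm.pow_const r
  cases s
  · exact h.indicator (measurableSet_lt measurable_snd measurable_fst)
  · exact h.indicator (measurableSet_lt measurable_fst measurable_snd)

theorem measurable_sideKernel_right (s : Side) (r x : ℝ) : Measurable (sideKernel s r x) :=
  (measurable_sideKernel s r).comp measurable_prodMk_left

/-- For x in (a, b) the visible region is (a, b) cut by a half-line. Moving the cut into the kernel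
leaves a domain independent of x, as Fubini requires. -/
theorem fracInt_eq_sideInt {a b x : ℝ} (hx : x ∈ Ioo a b) (β : ℝ) (s : Side) (f : ℝ → ℝ) :
    fracInt a b β s f x = (Real.Gamma β)⁻¹ * sideInt a b s β f x := by
  rw [fracInt, sideInt]
  congr 1
  rw [← integral_indicator (measurableSet_region a b x s), ← integral_indicator measurableSet_Ioo]
  congr 1
  funext t
  have h := hx.1
  have h' := hx.2
  cases s <;> simp only [sideKernel, Side.region, indicator_apply, mem_Ioo, mem_Iio, mem_Ioi]
  · by_cases h1 : a < t <;> by_cases h2 : t < x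
    · simp [h1, h2, h2.trans h']
    all_goals simp [h1, h2]
  · by_cases h1 : x < t <;> by_cases h2 : t < b
    · simp [h1, h2, h.trans h1]
    all_goals simp [h1, h2]

/-- This is the integrand of a convolution of two integrable functions, with f extended by zero,
restricted to the square. -/
theorem integrable_cutKernel_mul {a b r : ℝ} (hr : -1 < r) {f : ℝ → ℝ}
    (hf : IntegrableOn f (Ioo a b)) :
    Integrable (fun z : ℝ × ℝ => cutKernel r (b - a) (z.1 - z.2) * f z.2)
      ((volume.restrict (Ioo a b)).prod (volume.restrict (Ioo a b))) := by
  have hf' := (integrable_indicator_iff measurableSet_Ioo).2 hf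
  have h := hf'.convolution_integrand (ContinuousLinearMap.mul ℝ ℝ)
    (integrable_cutKernel hr (b - a))
  rw [Measure.prod_restrict]
  refine (h.integrableOn (s := Ioo a b ×ˢ Ioo a b)).congr_fun (fun z hz => ?_)
    (measurableSet_Ioo.prod measurableSet_Ioo)
  simp only [ContinuousLinearMap.mul_apply', indicator_of_mem hz.2, mul_comm]

theorem integrable_sideKernel_mul {a b r : ℝ} (hr : -1 < r) (s : Side) {f : ℝ → ℝ}
    (hf : IntegrableOn f (Ioo a b)) :
    Integrable (fun z : ℝ × ℝ => sideKernel s r z.1 z.2 * f z.2)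
      ((volume.restrict (Ioo a b)).prod (volume.restrict (Ioo a b))) := by
  refine (integrable_cutKernel_mul hr hf).mono
    ((measurable_sideKernel s r).aestronglyMeasurable.mul
      (hf.aestronglyMeasurable.comp_snd)) ?_
  rw [Measure.prod_restrict]
  refine (ae_restrict_iff' (measurableSet_Ioo.prod measurableSet_Ioo)).2 (ae_of_all _ fun z hz => ?_)
  rw [norm_mul, norm_mul, Real.norm_of_nonneg (sideKernel_nonneg _ _ _ _),
    Real.norm_of_nonneg (cutKernel_nonneg _ _ _)]
  exact mul_le_mul_of_nonneg_right (sideKernel_le_cutKernel hz.1 hz.2 s r) (norm_nonneg _)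

theorem integrable_sideInt {a b β : ℝ} (hβ : 0 < β) (s : Side) {f : ℝ → ℝ}
    (hf : IntegrableOn f (Ioo a b)) : IntegrableOn (sideInt a b s β f) (Ioo a b) :=
  (integrable_sideKernel_mul (by linarith) s hf).integral_prod_left

theorem integrable_bdd_mul {a b : ℝ} {f h : ℝ → ℝ} (hf : IntegrableOn f (Ioo a b))
    (hh : MemLp h ⊤ (volume.restrict (Ioo a b))) :
    IntegrableOn (fun x => f x * h x) (Ioo a b) :=
  Integrable.mul_of_top_left hf hh

/-- Fubini on the square with the kernel transposed. Boundedness of h makes the double integrand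
integrable although f is only in L¹. -/
theorem integral_mul_sideInt_opp {a b β : ℝ} (hβ : 0 < β) (s : Side) {f h : ℝ → ℝ}
    (hf : IntegrableOn f (Ioo a b)) (hh : MemLp h ⊤ (volume.restrict (Ioo a b))) :
    ∫ t in Ioo a b, f t * sideInt a b s.opp β h t = ∫ x in Ioo a b, sideInt a b s β f x * h x := by
  have h1 : Integrable (fun z : ℝ × ℝ => sideKernel s (β - 1) z.1 z.2 * f z.2 * h z.1)
      ((volume.restrict (Ioo a b)).prod (volume.restrict (Ioo a b))) :=
    Integrable.mul_of_top_left (integrable_sideKernel_mul (by linarith) s hf) (hh.comp_fst _)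
  have h2 := integral_integral_swap (f := fun x t => sideKernel s (β - 1) x t * f t * h x) h1
  simp only [sideInt, ← integral_mul_const, ← integral_const_mul, sideKernel_opp]
  rw [h2]
  refine integral_congr_ae (ae_of_all _ fun t => integral_congr_ae (ae_of_all _ fun x => ?_))
  simp only; ring

/-- The one-sided kernels are integrable, with total mass at most that of the cut-off kernel. -/
theorem setIntegral_sideKernel_le {a b r x : ℝ} (hr : -1 < r) (hx : x ∈ Ioo a b) (s : Side) :
    IntegrableOn (sideKernel s r x) (Ioo a b) ∧
    ∫ t in Ioo a b, sideKernel s r x t ≤ ∫ t, cutKernel r (b - a) t := by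
  have hK : Integrable (fun t => cutKernel r (b - a) (x - t)) :=
    (integrable_cutKernel hr (b - a)).comp_sub_left x
  have hle : ∀ᵐ t ∂(volume.restrict (Ioo a b)),
      sideKernel s r x t ≤ cutKernel r (b - a) (x - t) :=
    (ae_restrict_iff' measurableSet_Ioo).2
      (ae_of_all _ fun t ht => sideKernel_le_cutKernel hx ht s r)
  have hi : IntegrableOn (sideKernel s r x) (Ioo a b) := by
    refine Integrable.mono hK.integrableOn (measurable_sideKernel_right s r x).aestronglyMeasurable ?_
    filter_upwards [hle] with t ht
    rwa [Real.norm_of_nonneg (sideKernel_nonneg _ _ _ _),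
      Real.norm_of_nonneg (cutKernel_nonneg _ _ _)]
  refine ⟨hi, ?_⟩
  calc ∫ t in Ioo a b, sideKernel s r x t
      ≤ ∫ t in Ioo a b, cutKernel r (b - a) (x - t) :=
        integral_mono_ae hi hK.integrableOn hle
    _ ≤ ∫ t, cutKernel r (b - a) (x - t) :=
        setIntegral_le_integral hK (ae_of_all _ fun t => cutKernel_nonneg _ _ _)
    _ = ∫ t, cutKernel r (b - a) t :=
        integral_sub_left_eq_self (fun t => cutKernel r (b - a) t) volume x

/-- The mass of the kernel is bounded uniformly in x. Thus a one-sided integral of a bounded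
function is again an admissible factor in `integral_mul_sideInt_opp`, which can be iterated. -/
theorem memLp_top_sideInt {a b β : ℝ} (hβ : 0 < β) (s : Side) {h : ℝ → ℝ}
    (hh : MemLp h ⊤ (volume.restrict (Ioo a b))) :
    MemLp (sideInt a b s β h) ⊤ (volume.restrict (Ioo a b)) := by
  have hi : IntegrableOn h (Ioo a b) := hh.integrable le_top
  obtain ⟨M, hM⟩ : ∃ M : ℝ, ∀ᵐ t ∂(volume.restrict (Ioo a b)), ‖h t‖ ≤ M := by
    refine ⟨(eLpNormEssSup h (volume.restrict (Ioo a b))).toReal, ?_⟩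
    have hfin : eLpNormEssSup h (volume.restrict (Ioo a b)) ≠ ⊤ := by
      rw [← eLpNorm_exponent_top]; exact hh.2.ne
    filter_upwards [ae_le_eLpNormEssSup (f := h) (μ := volume.restrict (Ioo a b))] with t ht
    rw [← toReal_enorm]
    exact ENNReal.toReal_mono hfin ht
  refine memLp_top_of_bound (integrable_sideInt hβ s hi).aestronglyMeasurable
    ((∫ t, cutKernel (β - 1) (b - a) t) * |M|) ?_
  refine (ae_restrict_iff' measurableSet_Ioo).2 (ae_of_all _ fun x hx => ?_)
  obtain ⟨h1, h2⟩ := setIntegral_sideKernel_le (r := β - 1) (by linarith) hx s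
  calc ‖∫ t in Ioo a b, sideKernel s (β - 1) x t * h t‖
      ≤ ∫ t in Ioo a b, sideKernel s (β - 1) x t * |M| := by
        refine norm_integral_le_of_norm_le (h1.mul_const _) ?_
        filter_upwards [hM] with t ht
        rw [norm_mul, Real.norm_of_nonneg (sideKernel_nonneg _ _ _ _)]
        exact mul_le_mul_of_nonneg_left (ht.trans (le_abs_self M)) (sideKernel_nonneg _ _ _ _)
    _ ≤ _ := by
        rw [integral_mul_const]
        exact mul_le_mul_of_nonneg_right h2 (abs_nonneg M)

/-! ### The Beta integral and the semigroup law -/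

/-- The real part of the scaled complex Beta integral: on [0, c] both bases are nonnegative, so the
complex powers are real. -/
theorem integral_rpow_mul_rpow {β γ : ℝ} (hβ : 0 < β) (hγ : 0 < γ) {c : ℝ} (hc : 0 < c) :
    ∫ t in (0 : ℝ)..c, t ^ (β - 1) * (c - t) ^ (γ - 1) =
      ProbabilityTheory.beta β γ * c ^ (β + γ - 1) := by
  have h := Complex.betaIntegral_scaled β γ hc
  rw [ProbabilityTheory.beta_eq_betaIntegralReal β γ hβ hγ]
  have h3 : (∫ x in (0 : ℝ)..c, (x : ℂ) ^ ((β : ℂ) - 1) * ((c : ℂ) - x) ^ ((γ : ℂ) - 1)) =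
      ((∫ t in (0 : ℝ)..c, t ^ (β - 1) * (c - t) ^ (γ - 1) : ℝ) : ℂ) := by
    rw [← intervalIntegral.integral_ofReal]
    refine intervalIntegral.integral_congr fun x hx => ?_
    rw [uIcc_of_le hc.le] at hx
    rw [Complex.ofReal_mul, Complex.ofReal_cpow hx.1, Complex.ofReal_cpow (sub_nonneg.2 hx.2)]
    push_cast
    rfl
  have h4 : ((c : ℂ) ^ ((β : ℂ) + γ - 1)) = ((c ^ (β + γ - 1) : ℝ) : ℂ) := by
    rw [Complex.ofReal_cpow hc.le]; push_cast; rfl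
  rw [h3, h4] at h
  have h5 := congrArg Complex.re h
  rw [Complex.ofReal_re, Complex.re_ofReal_mul] at h5
  rw [h5, mul_comm]

theorem beta_comm (β γ : ℝ) : ProbabilityTheory.beta β γ = ProbabilityTheory.beta γ β := by
  simp [ProbabilityTheory.beta, mul_comm, add_comm]

/-- On the left, the substitution t ↦ x - t turns the product, supported between y and x, into a
Beta integrand; if x ≤ y the two supports do not meet. The right side follows by transposing both
kernels, which exchanges β and γ. -/
theorem setIntegral_sideKernel_mul_sideKernel {a b β γ x y : ℝ} (hβ : 0 < β) (hγ : 0 < γ)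
    (s : Side) (hx : x ∈ Ioo a b) (hy : y ∈ Ioo a b) :
    ∫ t in Ioo a b, sideKernel s (β - 1) x t * sideKernel s (γ - 1) t y =
      ProbabilityTheory.beta β γ * sideKernel s (β + γ - 1) x y := by
  have key : ∀ {β γ x y : ℝ}, 0 < β → 0 < γ → x ∈ Ioo a b → y ∈ Ioo a b →
      ∫ t in Ioo a b, sideKernel .left (β - 1) x t * sideKernel .left (γ - 1) t y =
      ProbabilityTheory.beta β γ * sideKernel .left (β + γ - 1) x y := by
    intro β γ x y hβ hγ hx hy
    rw [← integral_indicator measurableSet_Ioo]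
    rcases le_or_gt x y with h | h
    · have e : ∀ t, (Ioo a b).indicator (fun t => sideKernel .left (β - 1) x t *
          sideKernel .left (γ - 1) t y) t = 0 := by
        intro t
        refine indicator_apply_eq_zero.2 fun _ => ?_
        simp only [sideKernel, indicator_apply, mem_Iio]
        by_cases h1 : t < x
        · simp [(h1.trans_le h).le]
        · simp [h1]
      simp only [e, integral_zero]
      simp [sideKernel, h]
    · have e : ((Ioo a b).indicator fun t => sideKernel .left (β - 1) x t *
          sideKernel .left (γ - 1) t y) =
          (Ioo y x).indicator fun t => (x - t) ^ (β - 1) * (t - y) ^ (γ - 1) := by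
        funext t
        simp only [sideKernel, indicator_apply, mem_Iio, mem_Ioo]
        by_cases h1 : t < x <;> by_cases h2 : y < t
        · simp [h1, h2, hy.1.trans h2, h1.trans hx.2, abs_of_pos (sub_pos.2 h1),
            abs_of_pos (sub_pos.2 h2)]
        all_goals simp [h1, h2]
      rw [e, integral_indicator measurableSet_Ioo, ← integral_Ioc_eq_integral_Ioo,
        ← intervalIntegral.integral_of_le h.le]
      have h3 := intervalIntegral.integral_comp_sub_left (a := y) (b := x)
        (fun t => t ^ (β - 1) * (x - y - t) ^ (γ - 1)) x
      rw [sub_self, integral_rpow_mul_rpow hβ hγ (sub_pos.2 h)] at h3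
      have e2 : sideKernel .left (β + γ - 1) x y = (x - y) ^ (β + γ - 1) := by
        simp [sideKernel, h, abs_of_pos (sub_pos.2 h)]
      rw [e2, ← h3]
      refine intervalIntegral.integral_congr fun t _ => ?_
      congr 2
      ring
  cases s
  · exact key hβ hγ hx hy
  · have h : ∀ r x t, sideKernel .right r x t = sideKernel .left r t x :=
      fun r x t => sideKernel_opp .left r x t
    simp only [h]
    rw [beta_comm, add_comm β γ, ← key hγ hβ hy hx]
    simp only [mul_comm]

/-- Fubini again, in the form of `integral_mul_sideInt_opp` applied to the slice of the outer kernel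
at x, which is an integrable function. -/
theorem sideInt_sideInt {a b β γ x : ℝ} (hβ : 0 < β) (hγ : 0 < γ) (s : Side) {h : ℝ → ℝ}
    (hh : MemLp h ⊤ (volume.restrict (Ioo a b))) (hx : x ∈ Ioo a b) :
    sideInt a b s β (sideInt a b s γ h) x =
      ProbabilityTheory.beta β γ * sideInt a b s (β + γ) h x := by
  have hi : IntegrableOn h (Ioo a b) := hh.integrable le_top
  have h1 := (setIntegral_sideKernel_le (r := β - 1) (by linarith) hx s).1
  have hadj := integral_mul_sideInt_opp hγ s.opp h1 hh
  rw [Side.opp_opp] at hadj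
  have e : ∀ y ∈ Ioo a b, sideInt a b s.opp γ (sideKernel s (β - 1) x) y * h y =
      ProbabilityTheory.beta β γ * (sideKernel s (β + γ - 1) x y * h y) := by
    intro y hy
    rw [← mul_assoc, ← setIntegral_sideKernel_mul_sideKernel hβ hγ s hx hy]
    simp only [sideInt, sideKernel_opp, mul_comm]
  rw [sideInt, hadj, setIntegral_congr_fun measurableSet_Ioo e, integral_const_mul]
  rfl

/-! ### Test functions and the lemma of du Bois-Reymond -/

theorem ae_eq_zero_of_forall_testFunction {a b : ℝ} {f : ℝ → ℝ} (hf : IntegrableOn f (Ioo a b))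
    (h : ∀ φ, IsTestFunction a b φ → ∫ x in Ioo a b, f x * φ x = 0) :
    f =ᵐ[volume.restrict (Ioo a b)] 0 := by
  have h' := IsOpen.ae_eq_zero_of_integral_contDiff_smul_eq_zero (isOpen_Ioo (a := a) (b := b))
    hf.locallyIntegrableOn (fun φ h1 h2 h3 => ?_)
  · rw [Filter.EventuallyEq, ae_restrict_iff' measurableSet_Ioo]
    exact h'
  · rw [← setIntegral_eq_integral_of_forall_compl_eq_zero (s := Ioo a b) (fun x hx => by
      rw [image_eq_zero_of_notMem_tsupport (fun h => hx (h3 h)), zero_smul])]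
    simpa only [smul_eq_mul, mul_comm] using h φ ⟨h1, h2, h3⟩

namespace IsTestFunction

variable {a b : ℝ} {φ ψ : ℝ → ℝ}

theorem eq_zero (h : IsTestFunction a b φ) {x : ℝ} (hx : x ∉ Ioo a b) : φ x = 0 :=
  image_eq_zero_of_notMem_tsupport fun h' => hx (h.tsupport_subset h')

theorem setIntegral_eq (h : IsTestFunction a b φ) : ∫ x in Ioo a b, φ x = ∫ x, φ x :=
  setIntegral_eq_integral_of_forall_compl_eq_zero fun _ hx => h.eq_zero hx

theorem memLp_top (h : IsTestFunction a b φ) : MemLp φ ⊤ (volume.restrict (Ioo a b)) := by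
  obtain ⟨M, hM⟩ := h.hasCompactSupport.exists_bound_of_continuous h.contDiff.continuous
  exact memLp_top_of_bound h.contDiff.continuous.aestronglyMeasurable M (ae_of_all _ hM)

theorem deriv (h : IsTestFunction a b φ) : IsTestFunction a b (deriv φ) :=
  ⟨(contDiff_infty_iff_deriv.1 h.contDiff).2, h.hasCompactSupport.deriv,
    (closure_minimal (support_deriv_subset (f := φ)) (isClosed_tsupport φ)).trans
      h.tsupport_subset⟩

theorem sub (h : IsTestFunction a b φ) (h' : IsTestFunction a b ψ) :
    IsTestFunction a b (φ - ψ) :=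
  ⟨h.contDiff.sub h'.contDiff, h.hasCompactSupport.sub h'.hasCompactSupport,
    (tsupport_sub φ ψ).trans (union_subset h.tsupport_subset h'.tsupport_subset)⟩

theorem const_smul (c : ℝ) (h : IsTestFunction a b φ) : IsTestFunction a b (c • φ) :=
  ⟨h.contDiff.const_smul c, h.hasCompactSupport.smul_left (f := fun _ => c),
    (closure_mono (Function.support_const_smul_subset c φ)).trans h.tsupport_subset⟩

theorem exists_Icc (hab : a < b) (h : IsTestFunction a b φ) :
    ∃ c d, a < c ∧ d < b ∧ ∀ x, x ∉ Icc c d → φ x = 0 := by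
  rcases (tsupport φ).eq_empty_or_nonempty with h0 | h0
  -- For φ = 0 the exchanged endpoints make the interval empty.
  · exact ⟨b, a, hab, hab, fun x _ => image_eq_zero_of_notMem_tsupport (by simp [h0])⟩
  · obtain ⟨c, hc⟩ := h.hasCompactSupport.isCompact.exists_isLeast h0
    obtain ⟨d, hd⟩ := h.hasCompactSupport.isCompact.exists_isGreatest h0
    exact ⟨c, d, (h.tsupport_subset hc.1).1, (h.tsupport_subset hd.1).2,
      fun x hx => image_eq_zero_of_notMem_tsupport fun hx' => hx ⟨hc.2 hx', hd.2 hx'⟩⟩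

/-- The primitive from a vanishes to the left of the support of ψ, and to the right of it because ψ
has total integral zero; hence its support is compact in (a, b). -/
theorem exists_antideriv (hab : a < b) (h : IsTestFunction a b ψ) (h0 : ∫ x, ψ x = 0) :
    ∃ φ, IsTestFunction a b φ ∧ _root_.deriv φ = ψ := by
  obtain ⟨c, d, hc, hd, hcd⟩ := h.exists_Icc hab
  have hψ := h.contDiff.continuous
  have hder : ∀ x, HasDerivAt (fun x => ∫ t in a..x, ψ t) (ψ x) x := fun x =>
    intervalIntegral.integral_hasDerivAt_right (hψ.intervalIntegrable _ _)
      hψ.aestronglyMeasurable.stronglyMeasurableAtFilter hψ.continuousAt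
  have hd' : _root_.deriv (fun x => ∫ t in a..x, ψ t) = ψ := funext fun x => (hder x).deriv
  have hsupp : ∀ x, x ∉ Icc c d → ∫ t in a..x, ψ t = 0 := by
    intro x hx
    by_cases hxc : x < c
    · refine intervalIntegral.integral_zero_ae (ae_of_all _ fun t ht => hcd t fun ht' => ?_)
      have := ht.2
      have : t < c := this.trans_lt (max_lt hc hxc)
      exact absurd ht'.1 (not_le.2 this)
    · have hdx : d < x := by
        by_contra hdx; exact hx ⟨not_lt.1 hxc, not_lt.1 hdx⟩
      rw [intervalIntegral.integral_eq_integral_of_support_subset, h0]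
      intro t ht
      have ht' : t ∈ Icc c d := by
        by_contra hn; exact ht (hcd t hn)
      exact ⟨hc.trans_le ht'.1, ht'.2.trans hdx.le⟩
  have hts : tsupport (fun x => ∫ t in a..x, ψ t) ⊆ Icc c d :=
    closure_minimal (fun x hx => by by_contra hn; exact hx (hsupp x hn)) isClosed_Icc
  refine ⟨fun x => ∫ t in a..x, ψ t, ⟨?_, ?_, ?_⟩, hd'⟩
  · rw [contDiff_infty_iff_deriv, hd']
    exact ⟨fun x => (hder x).differentiableAt, h.contDiff⟩
  · exact HasCompactSupport.of_support_subset_isCompact isCompact_Icc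
      ((subset_tsupport _).trans hts)
  · exact hts.trans fun x hx => ⟨hc.trans_le hx.1, hx.2.trans_lt hd⟩

theorem exists_integral_eq_one (hab : a < b) :
    ∃ φ, IsTestFunction a b φ ∧ ∫ x, φ x = 1 := by
  let B : ContDiffBump ((a + b) / 2) := ⟨(b - a) / 8, (b - a) / 4, by linarith, by linarith⟩
  refine ⟨B.normed volume, ⟨B.contDiff_normed, B.hasCompactSupport_normed, ?_⟩, B.integral_normed⟩
  rw [B.tsupport_normed_eq, Real.closedBall_eq_Icc]
  intro x hx
  have h1 : (a + b) / 2 - (b - a) / 4 ≤ x := hx.1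
  have h2 : x ≤ (a + b) / 2 + (b - a) / 4 := hx.2
  constructor <;> linarith

/-- The fundamental theorem of calculus with φ vanishing at the base point; the sign records the
orientation. -/
theorem sideInt_one_deriv (h : IsTestFunction a b φ) (s : Side) {x : ℝ} (hx : x ∈ Ioo a b) :
    sideInt a b s 1 (_root_.deriv φ) x = s.sign * φ x := by
  have h1 := fracInt_eq_sideInt hx 1 s (_root_.deriv φ)
  rw [Real.Gamma_one, inv_one, one_mul] at h1
  rw [← h1, fracInt, Real.Gamma_one, inv_one, one_mul]
  simp only [sub_self, Real.rpow_zero, one_mul]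
  have hF : ∀ c d, ∫ t in c..d, _root_.deriv φ t = φ d - φ c := fun c d =>
    intervalIntegral.integral_deriv_eq_sub
      (fun t _ => (h.contDiff.differentiable (by simp)).differentiableAt)
      ((h.contDiff.continuous_deriv (by simp)).intervalIntegrable _ _)
  cases s
  · rw [Side.region, ← integral_Ioc_eq_integral_Ioo, ← intervalIntegral.integral_of_le hx.1.le, hF,
      h.eq_zero (x := a) (by simp)]
    simp [Side.sign]
  · rw [Side.region, ← integral_Ioc_eq_integral_Ioo, ← intervalIntegral.integral_of_le hx.2.le, hF,
      h.eq_zero (x := b) (by simp)]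
    simp [Side.sign]

end IsTestFunction

/-- The lemma of du Bois-Reymond. -/
theorem exists_ae_eq_const_of_forall_integral_mul_deriv {a b : ℝ} (hab : a < b) {f : ℝ → ℝ}
    (hf : IntegrableOn f (Ioo a b))
    (h : ∀ φ, IsTestFunction a b φ → ∫ x in Ioo a b, f x * deriv φ x = 0) :
    ∃ c, f =ᵐ[volume.restrict (Ioo a b)] fun _ => c := by
  -- Subtracting (∫ ψ) ρ from a test function ψ leaves integral zero, hence a derivative of a test
  -- function. This forces the constant to be ∫ f ρ.
  obtain ⟨ρ, hρ, hρ1⟩ := IsTestFunction.exists_integral_eq_one hab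
  refine ⟨∫ x in Ioo a b, f x * ρ x, ?_⟩
  set c := ∫ x in Ioo a b, f x * ρ x with hc
  have hcI : IntegrableOn (fun _ : ℝ => c) (Ioo a b) := integrableOn_const (by simp)
  have h0 := ae_eq_zero_of_forall_testFunction (hf.sub hcI) fun ψ hψ => by
    have hψi : Integrable ψ := hψ.contDiff.continuous.integrable_of_hasCompactSupport
      hψ.hasCompactSupport
    have hρi : Integrable ρ := hρ.contDiff.continuous.integrable_of_hasCompactSupport
      hρ.hasCompactSupport
    obtain ⟨φ, hφ, hφ'⟩ := (hψ.sub (hρ.const_smul (∫ x, ψ x))).exists_antideriv hab (by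
      simp only [Pi.sub_apply, Pi.smul_apply, smul_eq_mul]
      rw [integral_sub hψi (hρi.const_mul _), integral_const_mul, hρ1, mul_one, sub_self])
    have h1 := h φ hφ
    have h2 := integrable_bdd_mul hf hψ.memLp_top
    have h3 := integrable_bdd_mul hf hρ.memLp_top
    simp only [hφ', Pi.sub_apply, Pi.smul_apply, smul_eq_mul, mul_sub] at h1
    rw [integral_sub h2 (by simpa only [mul_left_comm] using h3.const_mul (∫ x, ψ x))] at h1
    simp only [mul_left_comm _ (∫ x, ψ x)] at h1
    rw [integral_const_mul, ← hc, ← hψ.setIntegral_eq] at h1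
    simp only [Pi.sub_apply, sub_mul]
    rw [integral_sub h2 (hψi.integrableOn.const_mul c), integral_const_mul]
    linarith
  filter_upwards [h0] with x hx
  exact sub_eq_zero.1 hx

/-! ### Recovering a function from its weak fractional derivative -/

/-- The base point of a one-sided operator. -/
def Side.base (a b : ℝ) : Side → ℝ
  | .left => a
  | .right => b

theorem integrableOn_base_rpow (a b : ℝ) {r : ℝ} (hr : -1 < r) (s : Side) :
    IntegrableOn (fun x => |x - s.base a b| ^ r) (Ioo a b) := by
  have h := (integrable_cutKernel hr (b - a + 1)).comp_sub_right (s.base a b)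
  refine (h.integrableOn (s := Ioo a b)).congr_fun (fun x hx => ?_) measurableSet_Ioo
  refine indicator_of_mem ?_ _
  have h1 := hx.1
  have h2 := hx.2
  cases s <;> constructor <;> simp only [Side.base] <;> linarith

theorem integral_base_rpow_pos {a b : ℝ} (hab : a < b) {r : ℝ} (hr : -1 < r) (s : Side) :
    0 < ∫ x in Ioo a b, |x - s.base a b| ^ r := by
  have hpos : ∀ x ∈ Ioo a b, 0 < |x - s.base a b| ^ r := by
    intro x hx
    refine Real.rpow_pos_of_pos (abs_pos.2 (sub_ne_zero.2 ?_)) r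
    cases s
    · exact hx.1.ne'
    · exact hx.2.ne
  rw [setIntegral_pos_iff_support_of_nonneg_ae
    (ae_of_all _ fun x => by simp only [Pi.zero_apply]; positivity)
    (integrableOn_base_rpow a b hr s)]
  have : Function.support (fun x => |x - s.base a b| ^ r) ∩ Ioo a b = Ioo a b :=
    inter_eq_right.2 fun x hx => (hpos x hx).ne'
  rw [this]
  simpa using hab

/-- A reflection of the interval between the base point and x. Written as an order-one integral, the
image of a constant can be integrated by parts in the ordinary sense; this is where the homogeneous
term |x - e|^(α-1) of the representation comes from. -/
theorem sideInt_one_eq_sideInt_base {a b β x : ℝ} (s : Side) (hx : x ∈ Ioo a b) :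
    sideInt a b s β (fun _ => 1) x =
      sideInt a b s 1 (fun t => |t - s.base a b| ^ (β - 1)) x := by
  have h1 : ∀ (β : ℝ) (f : ℝ → ℝ), sideInt a b s β f x =
      ∫ t in s.region a b x, |x - t| ^ (β - 1) * f t := by
    intro β f
    have h := fracInt_eq_sideInt hx 1 s (fun t => |x - t| ^ (β - 1) * f t)
    rw [fracInt, Real.Gamma_one, inv_one, one_mul, one_mul] at h
    simp only [sub_self, Real.rpow_zero, one_mul] at h
    rw [h, sideInt, sideInt]
    congr 1
    funext t
    cases s <;> simp only [sideKernel, indicator_apply] <;> split_ifs <;> simp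
  rw [h1, h1]
  simp only [sub_self, Real.rpow_zero, one_mul, mul_one]
  cases s
  · rw [Side.region, ← integral_Ioc_eq_integral_Ioo, ← intervalIntegral.integral_of_le hx.1.le,
      ← integral_Ioc_eq_integral_Ioo, ← intervalIntegral.integral_of_le hx.1.le, Side.base]
    have h := intervalIntegral.integral_comp_sub_left (a := a) (b := x)
      (fun t => |t - a| ^ (β - 1)) (a + x)
    simp only [add_sub_cancel_left, add_sub_cancel_right] at h
    rw [← h]
    congr 1; funext t; congr 2; ring
  · rw [Side.region, ← integral_Ioc_eq_integral_Ioo, ← intervalIntegral.integral_of_le hx.2.le,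
      ← integral_Ioc_eq_integral_Ioo, ← intervalIntegral.integral_of_le hx.2.le, Side.base]
    have h := intervalIntegral.integral_comp_sub_left (a := x) (b := b)
      (fun t => |t - b| ^ (β - 1)) (x + b)
    simp only [add_sub_cancel_left, add_sub_cancel_right] at h
    rw [← h]
    congr 1; funext t; congr 2; ring

/-- The fundamental theorem of calculus for weak fractional derivatives. -/
theorem IsWeakFracDeriv.exists_ae_eq {a b α : ℝ} (hab : a < b) (hα : α ∈ Ioo (0 : ℝ) 1) {s : Side}
    {u g : ℝ → ℝ} (hu : IntegrableOn u (Ioo a b)) (hg : IntegrableOn g (Ioo a b))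
    (h : IsWeakFracDeriv a b α s u g) :
    ∃ c, u =ᵐ[volume.restrict (Ioo a b)] fun x => c * |x - s.base a b| ^ (α - 1) +
      (ProbabilityTheory.beta (1 - α) α)⁻¹ * Real.Gamma (1 - α) * sideInt a b s α g x := by
  have hα0 := hα.1
  have hα1 : 0 < 1 - α := sub_pos.2 hα.2
  have hB : ProbabilityTheory.beta (1 - α) α ≠ 0 := (ProbabilityTheory.beta_pos hα1 hα0).ne'
  have hΓ : Real.Gamma (1 - α) ≠ 0 := (Real.Gamma_pos_of_pos hα1).ne'
  set B := ProbabilityTheory.beta (1 - α) α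
  set Γ := Real.Gamma (1 - α)
  have hss := s.sign_mul_self
  -- integration by parts against the order-one integral
  have hparts : ∀ {f φ : ℝ → ℝ}, IntegrableOn f (Ioo a b) → IsTestFunction a b φ →
      ∫ x in Ioo a b, sideInt a b s 1 f x * deriv φ x = -s.sign * ∫ x in Ioo a b, f x * φ x := by
    intro f φ hf hφ
    rw [← integral_mul_sideInt_opp one_pos s hf hφ.deriv.memLp_top, ← integral_const_mul]
    refine setIntegral_congr_fun measurableSet_Ioo fun x hx => ?_
    simp only [hφ.sideInt_one_deriv s.opp hx, s.sign_opp]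
    ring
  have hw := integrable_sideInt hα1 s hu
  have hG := integrable_sideInt one_pos s hg
  -- Writing J for the unnormalised integrals, the transposed weak identity says that J^(1-α) u - Γ
  -- J¹ g is orthogonal to every φ', hence constant.
  obtain ⟨c, hc⟩ := exists_ae_eq_const_of_forall_integral_mul_deriv hab
    (hw.sub (hG.const_mul Γ)) fun φ hφ => by
      have h1 := h.integral_eq φ hφ
      have h2 : ∫ x in Ioo a b, u x * classicalFracDeriv a b α s.opp φ x =
          -s.sign * Γ⁻¹ * ∫ x in Ioo a b, sideInt a b s (1 - α) u x * deriv φ x := by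
        rw [← integral_mul_sideInt_opp hα1 s hu hφ.deriv.memLp_top, ← integral_const_mul]
        refine setIntegral_congr_fun measurableSet_Ioo fun x hx => ?_
        simp only [classicalFracDeriv, fracInt_eq_sideInt hx, s.sign_opp]
        ring
      simp only [Pi.sub_apply, sub_mul, mul_assoc]
      rw [integral_sub (integrable_bdd_mul hw hφ.deriv.memLp_top)
        ((integrable_bdd_mul hG hφ.deriv.memLp_top).const_mul Γ), integral_const_mul, hparts hg hφ,
        h1, h2]
      field_simp
      linear_combination (-(∫ x in Ioo a b, sideInt a b s (1 - α) u x * deriv φ x)) * hss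
  -- Formally, J^α is applied to J^(1-α) u = c + Γ J¹ g, the left side becomes B J¹ u, and the
  -- result is differentiated. The differentiation is avoided by testing with ψ and pairing with J^α
  -- ψ' on the opposite side.
  refine ⟨B⁻¹ * c, ?_⟩
  have he := integrableOn_base_rpow a b (r := α - 1) (by linarith) s
  have hJ := integrable_sideInt hα0 s hg
  have h1' : IntegrableOn (fun _ : ℝ => (1 : ℝ)) (Ioo a b) := integrableOn_const (by simp)
  have h0 := ae_eq_zero_of_forall_testFunction
    (f := fun x => u x - (B⁻¹ * c * |x - s.base a b| ^ (α - 1) + B⁻¹ * Γ * sideInt a b s α g x))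
    (hu.sub ((he.const_mul _).add (hJ.const_mul _))) fun ψ hψ => by
    have hψ' := hψ.deriv.memLp_top
    have hJψ := memLp_top_sideInt hα0 s.opp hψ'
    -- the pairing of `u` with `ψ` through the semigroup property
    have k1 : ∫ x in Ioo a b, u x * ψ x = -s.sign * B⁻¹ *
        ∫ x in Ioo a b, sideInt a b s (1 - α) u x * sideInt a b s.opp α (deriv ψ) x := by
      rw [← integral_mul_sideInt_opp hα1 s hu hJψ, ← integral_const_mul]
      refine setIntegral_congr_fun measurableSet_Ioo fun x hx => ?_
      rw [sideInt_sideInt hα1 hα0 s.opp hψ' hx, sub_add_cancel, hψ.sideInt_one_deriv s.opp hx,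
        s.sign_opp, show ProbabilityTheory.beta (1 - α) α = B from rfl]
      field_simp
      linear_combination (-(u x * ψ x)) * hss
    have k2 : ∫ x in Ioo a b, sideInt a b s (1 - α) u x * sideInt a b s.opp α (deriv ψ) x =
        c * (∫ x in Ioo a b, 1 * sideInt a b s.opp α (deriv ψ) x) +
          Γ * ∫ x in Ioo a b, sideInt a b s 1 g x * sideInt a b s.opp α (deriv ψ) x := by
      rw [← integral_const_mul, ← integral_const_mul,
        ← integral_add ((integrable_bdd_mul h1' hJψ).const_mul c)
          ((integrable_bdd_mul hG hJψ).const_mul Γ)]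
      refine integral_congr_ae ?_
      filter_upwards [hc] with x hx
      have hx' : sideInt a b s (1 - α) u x = c + Γ * sideInt a b s 1 g x := by
        simp only [Pi.sub_apply] at hx
        linarith
      rw [hx']; ring
    have k3 : ∫ x in Ioo a b, 1 * sideInt a b s.opp α (deriv ψ) x =
        -s.sign * ∫ x in Ioo a b, |x - s.base a b| ^ (α - 1) * ψ x := by
      rw [integral_mul_sideInt_opp hα0 s h1' hψ', ← hparts he hψ]
      refine setIntegral_congr_fun measurableSet_Ioo fun x hx => ?_
      simp only [sideInt_one_eq_sideInt_base s hx]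
    have k4 : ∫ x in Ioo a b, sideInt a b s 1 g x * sideInt a b s.opp α (deriv ψ) x =
        -s.sign * ∫ x in Ioo a b, sideInt a b s α g x * ψ x := by
      rw [← integral_mul_sideInt_opp one_pos s hg hJψ, ← integral_mul_sideInt_opp hα0 s hg
        hψ.memLp_top, ← integral_const_mul]
      refine setIntegral_congr_fun measurableSet_Ioo fun x hx => ?_
      have e : sideInt a b s.opp α (sideInt a b s.opp 1 (deriv ψ)) x =
          -s.sign * sideInt a b s.opp α ψ x := by
        rw [sideInt, sideInt, ← integral_const_mul]
        refine setIntegral_congr_fun measurableSet_Ioo fun t ht => ?_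
        simp only [hψ.sideInt_one_deriv s.opp ht, s.sign_opp]
        ring
      -- The orders 1 and α commute, since both compositions are the same multiple of J^(1+α).
      rw [sideInt_sideInt one_pos hα0 s.opp hψ' hx, add_comm, beta_comm,
        ← sideInt_sideInt hα0 one_pos s.opp hψ' hx, e]
      ring
    have i1 := (integrable_bdd_mul he hψ.memLp_top).const_mul (B⁻¹ * c)
    have i2 := (integrable_bdd_mul hJ hψ.memLp_top).const_mul (B⁻¹ * Γ)
    simp only [sub_mul, add_mul, mul_assoc (B⁻¹ * c), mul_assoc (B⁻¹ * Γ)]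
    rw [integral_sub (g := fun x => B⁻¹ * c * (|x - s.base a b| ^ (α - 1) * ψ x) +
      B⁻¹ * Γ * (sideInt a b s α g x * ψ x)) (integrable_bdd_mul hu hψ.memLp_top) (i1.add i2),
      integral_add i1 i2,
      integral_const_mul, integral_const_mul, k1, k2, k3, k4]
    linear_combination (B⁻¹ * c * (∫ x in Ioo a b, |x - s.base a b| ^ (α - 1) * ψ x) +
      B⁻¹ * Γ * ∫ x in Ioo a b, sideInt a b s α g x * ψ x) * hss
  filter_upwards [h0] with x hx
  exact sub_eq_zero.1 hx

/-! ### One-sided integrals turn weak into strong convergence -/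

/-- The part of the convolution kernel `|s| ^ r` above the level `n`. -/
def cutKernelExcess (r c : ℝ) (n : ℕ) (y : ℝ) : ℝ := max (cutKernel r c y - n) 0

theorem cutKernelExcess_nonneg (r c : ℝ) (n : ℕ) (y : ℝ) : 0 ≤ cutKernelExcess r c n y :=
  le_max_right _ _

theorem cutKernelExcess_le (r c : ℝ) (n : ℕ) (y : ℝ) :
    cutKernelExcess r c n y ≤ cutKernel r c y :=
  max_le (sub_le_self _ n.cast_nonneg) (cutKernel_nonneg r c y)

theorem measurable_cutKernelExcess (r c : ℝ) (n : ℕ) : Measurable (cutKernelExcess r c n) := by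
  have h : Measurable (cutKernel r c) :=
    (measurable_norm.pow_const r).indicator measurableSet_Ioo
  exact (h.sub_const _).max measurable_const

theorem integrable_cutKernelExcess {r : ℝ} (hr : -1 < r) (c : ℝ) (n : ℕ) :
    Integrable (cutKernelExcess r c n) := by
  refine (integrable_cutKernel hr c).mono
    (measurable_cutKernelExcess r c n).aestronglyMeasurable (ae_of_all _ fun y => ?_)
  rw [Real.norm_of_nonneg (cutKernelExcess_nonneg _ _ _ _),
    Real.norm_of_nonneg (cutKernel_nonneg _ _ _)]
  exact cutKernelExcess_le r c n y

/-- Dominated convergence: at each point the excess vanishes once n reaches the finite value of the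
kernel there. -/
theorem tendsto_integral_cutKernelExcess {r : ℝ} (hr : -1 < r) (c : ℝ) :
    Tendsto (fun n => ∫ y, cutKernelExcess r c n y) atTop (𝓝 0) := by
  rw [← integral_zero ℝ ℝ (μ := volume)]
  refine tendsto_integral_of_dominated_convergence (cutKernel r c)
    (fun n => (measurable_cutKernelExcess r c n).aestronglyMeasurable)
    (integrable_cutKernel hr c) (fun n => ae_of_all _ fun y => ?_) (ae_of_all _ fun y => ?_)
  · rw [Real.norm_of_nonneg (cutKernelExcess_nonneg _ _ _ _)]
    exact cutKernelExcess_le r c n y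
  · obtain ⟨N, hN⟩ := exists_nat_ge (cutKernel r c y)
    refine tendsto_const_nhds.congr' ?_
    filter_upwards [eventually_ge_atTop N] with n hn
    have : (N : ℝ) ≤ n := by exact_mod_cast hn
    rw [cutKernelExcess, max_eq_right (by linarith)]

theorem integrable_cutKernelExcess_mul {a b r : ℝ} (hr : -1 < r) (n : ℕ) {f : ℝ → ℝ}
    (hf : IntegrableOn f (Ioo a b)) :
    Integrable (fun z : ℝ × ℝ => cutKernelExcess r (b - a) n (z.1 - z.2) * |f z.2|)
      ((volume.restrict (Ioo a b)).prod (volume.restrict (Ioo a b))) := by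
  refine (integrable_cutKernel_mul hr hf).mono
    (((measurable_cutKernelExcess r (b - a) n).comp
      (measurable_fst.sub measurable_snd)).aestronglyMeasurable.mul
      (hf.abs.aestronglyMeasurable.comp_snd)) (ae_of_all _ fun z => ?_)
  rw [norm_mul, norm_mul, Real.norm_of_nonneg (cutKernelExcess_nonneg _ _ _ _),
    Real.norm_of_nonneg (cutKernel_nonneg _ _ _), Real.norm_eq_abs, abs_abs, Real.norm_eq_abs]
  exact mul_le_mul_of_nonneg_right (cutKernelExcess_le _ _ _ _) (abs_nonneg _)

/-- Integrating in x first, all translates of the excess have the same mass. The bound sees f only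
through its L¹ norm. -/
theorem integral_integral_cutKernelExcess_le {a b r : ℝ} (hr : -1 < r) (n : ℕ) {f : ℝ → ℝ}
    (hf : IntegrableOn f (Ioo a b)) :
    ∫ x in Ioo a b, ∫ t in Ioo a b, cutKernelExcess r (b - a) n (x - t) * |f t| ≤
      (∫ y, cutKernelExcess r (b - a) n y) * ∫ t in Ioo a b, |f t| := by
  have hi := integrable_cutKernelExcess_mul hr n hf
  rw [integral_integral_swap (f := fun x t => cutKernelExcess r (b - a) n (x - t) * |f t|) hi,
    ← integral_const_mul]
  refine integral_mono hi.integral_prod_right (hf.abs.const_mul _) fun t => ?_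
  simp only
  rw [integral_mul_const]
  refine mul_le_mul_of_nonneg_right ?_ (abs_nonneg _)
  calc ∫ x in Ioo a b, cutKernelExcess r (b - a) n (x - t)
      ≤ ∫ x, cutKernelExcess r (b - a) n (x - t) :=
        setIntegral_le_integral ((integrable_cutKernelExcess hr (b - a) n).comp_sub_right t)
          (ae_of_all _ fun x => cutKernelExcess_nonneg _ _ _ _)
    _ = _ := integral_sub_right_eq_self (cutKernelExcess r (b - a) n) t

theorem memLp_top_min_sideKernel (a b : ℝ) (s : Side) (r x : ℝ) (n : ℕ) :
    MemLp (fun t => min (sideKernel s r x t) n) ⊤ (volume.restrict (Ioo a b)) := by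
  refine memLp_top_of_bound
    ((measurable_sideKernel_right s r x).min measurable_const).aestronglyMeasurable n
    (ae_of_all _ fun t => ?_)
  rw [Real.norm_of_nonneg (le_min (sideKernel_nonneg _ _ _ _) n.cast_nonneg)]
  exact min_le_right _ _

/-- The kernel is split into its truncation at n, which weak convergence can handle, and a remainder
below the excess of the convolution kernel, which is small uniformly over L¹-bounded f. -/
theorem integral_abs_sideInt_le {a b β : ℝ} (hβ : 0 < β) (s : Side) (n : ℕ) {f : ℝ → ℝ}
    (hf : IntegrableOn f (Ioo a b)) :
    ∫ x in Ioo a b, |sideInt a b s β f x| ≤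
      (∫ x in Ioo a b, |∫ t in Ioo a b, f t * min (sideKernel s (β - 1) x t) n|) +
      (∫ y, cutKernelExcess (β - 1) (b - a) n y) * ∫ t in Ioo a b, |f t| := by
  have hr : -1 < β - 1 := by linarith
  refine le_trans ?_ (add_le_add_right (integral_integral_cutKernelExcess_le hr n hf) _)
  have hE := integrable_cutKernelExcess_mul hr n hf
  have hm : Integrable (fun z : ℝ × ℝ => f z.2 * min (sideKernel s (β - 1) z.1 z.2) n)
      ((volume.restrict (Ioo a b)).prod (volume.restrict (Ioo a b))) := by
    refine Integrable.mul_of_top_left (hf.comp_snd _) (memLp_top_of_bound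
      ((measurable_sideKernel s _).min measurable_const).aestronglyMeasurable n
      (ae_of_all _ fun z => ?_))
    rw [Real.norm_of_nonneg (le_min (sideKernel_nonneg _ _ _ _) n.cast_nonneg)]
    exact min_le_right _ _
  rw [← integral_add hm.integral_prod_left.abs hE.integral_prod_left]
  refine integral_mono_ae (integrable_sideInt hβ s hf).abs
    (hm.integral_prod_left.abs.add hE.integral_prod_left) ?_
  filter_upwards [hm.prod_right_ae, hE.prod_right_ae,
    (integrable_sideKernel_mul hr s hf).prod_right_ae, ae_restrict_mem measurableSet_Ioo]
    with x h1 h2 h3 hx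
  have e : sideInt a b s β f x = (∫ t in Ioo a b, f t * min (sideKernel s (β - 1) x t) n) +
      ∫ t in Ioo a b, (sideKernel s (β - 1) x t * f t -
        f t * min (sideKernel s (β - 1) x t) n) := by
    rw [integral_sub h3 h1, sideInt]; ring
  rw [e]
  refine (abs_add_le _ _).trans (add_le_add_right ?_ _)
  rw [← Real.norm_eq_abs]
  refine norm_integral_le_of_norm_le h2 ?_
  refine (ae_restrict_iff' measurableSet_Ioo).2 (ae_of_all _ fun t ht => ?_)
  rw [mul_comm (f t), ← sub_mul, norm_mul, Real.norm_eq_abs (f t)]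
  refine mul_le_mul_of_nonneg_right ?_ (abs_nonneg _)
  rw [Real.norm_of_nonneg (sub_nonneg.2 (min_le_left _ _)), cutKernelExcess]
  have h4 := sideKernel_le_cutKernel hx ht s (β - 1)
  rcases le_total (sideKernel s (β - 1) x t) n with h5 | h5
  · rw [min_eq_left h5, sub_self]; exact le_max_right _ _
  · rw [min_eq_right h5]; exact (sub_le_sub_right h4 _).trans (le_max_left _ _)

/-- Convergence of the functions `f k` to `g` against all bounded functions. -/
def TendstoWeakly {X : Type*} [MeasurableSpace X] (μ : Measure X) (f : ℕ → X → ℝ) (g : X → ℝ) :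
    Prop :=
  ∀ h : X → ℝ, MemLp h ⊤ μ → Tendsto (fun k => ∫ x, f k x * h x ∂μ) atTop (𝓝 (∫ x, g x * h x ∂μ))

theorem sideInt_sub_ae {a b β : ℝ} (hβ : 0 < β) (s : Side) {f g : ℝ → ℝ}
    (hf : IntegrableOn f (Ioo a b)) (hg : IntegrableOn g (Ioo a b)) :
    sideInt a b s β (f - g) =ᵐ[volume.restrict (Ioo a b)]
      fun x => sideInt a b s β f x - sideInt a b s β g x := by
  have hr : -1 < β - 1 := by linarith
  filter_upwards [(integrable_sideKernel_mul hr s hf).prod_right_ae,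
    (integrable_sideKernel_mul hr s hg).prod_right_ae] with x h1 h2
  simp only [sideInt, Pi.sub_apply, mul_sub]
  exact integral_sub h1 h2

/-- For fixed x and n the truncated kernel is a bounded function of t, so the truncated integrals
tend to zero pointwise, dominated by the constant n B'. The level n is fixed first, making the
remainder less than ε/2 for all k at once. -/
theorem tendsto_integral_abs_sideInt_sub {a b β : ℝ} (hβ : 0 < β) (s : Side)
    {f : ℕ → ℝ → ℝ} {g : ℝ → ℝ} (hf : ∀ k, IntegrableOn (f k) (Ioo a b))
    (hg : IntegrableOn g (Ioo a b)) (hfg : TendstoWeakly (volume.restrict (Ioo a b)) f g)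
    {B : ℝ} (hB : ∀ k, ∫ x in Ioo a b, |f k x| ≤ B) :
    Tendsto (fun k => ∫ x in Ioo a b, |sideInt a b s β (f k) x - sideInt a b s β g x|)
      atTop (𝓝 0) := by
  have hr : -1 < β - 1 := by linarith
  set B' := B + ∫ x in Ioo a b, |g x|
  have hd : ∀ k, ∫ x in Ioo a b, |(f k - g) x| ≤ B' := by
    intro k
    calc ∫ x in Ioo a b, |(f k - g) x| ≤ ∫ x in Ioo a b, (|f k x| + |g x|) :=
          integral_mono ((hf k).sub hg).abs ((hf k).abs.add hg.abs) fun x => abs_sub _ _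
      _ ≤ B' := by
          rw [integral_add (hf k).abs hg.abs]
          exact add_le_add_left (hB k) _
  have e : ∀ k, ∫ x in Ioo a b, |sideInt a b s β (f k) x - sideInt a b s β g x| =
      ∫ x in Ioo a b, |sideInt a b s β (f k - g) x| := by
    intro k
    refine integral_congr_ae ?_
    filter_upwards [sideInt_sub_ae hβ s (hf k) hg] with x hx
    rw [hx]
  simp only [e]
  -- the bounded part of the kernel
  have hmain : ∀ n : ℕ, Tendsto (fun k => ∫ x in Ioo a b,
      |∫ t in Ioo a b, (f k - g) t * min (sideKernel s (β - 1) x t) n|) atTop (𝓝 0) := by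
    intro n
    rw [← integral_zero ℝ ℝ (μ := volume.restrict (Ioo a b))]
    refine tendsto_integral_of_dominated_convergence (fun _ => (n : ℝ) * B') (fun k => ?_)
      (integrable_const _) (fun k => ae_of_all _ fun x => ?_) (ae_of_all _ fun x => ?_)
    · have h : AEStronglyMeasurable (fun z : ℝ × ℝ => (f k - g) z.2 *
          min (sideKernel s (β - 1) z.1 z.2) n)
          ((volume.restrict (Ioo a b)).prod (volume.restrict (Ioo a b))) :=
        ((hf k).sub hg).aestronglyMeasurable.comp_snd.mul
          ((measurable_sideKernel s _).min measurable_const).aestronglyMeasurable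
      exact h.integral_prod_right'.norm
    · rw [Real.norm_eq_abs, abs_abs]
      rw [← Real.norm_eq_abs]
      refine (norm_integral_le_of_norm_le (((hf k).sub hg).abs.const_mul (n : ℝ))
        (ae_of_all _ fun t => ?_)).trans ?_
      · rw [norm_mul, mul_comm, Real.norm_eq_abs ((f k - g) t),
          Real.norm_of_nonneg (le_min (sideKernel_nonneg _ _ _ _) n.cast_nonneg)]
        exact mul_le_mul_of_nonneg_right (min_le_right _ _) (abs_nonneg _)
      · rw [integral_const_mul]
        exact mul_le_mul_of_nonneg_left (hd k) n.cast_nonneg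
    · have hh := memLp_top_min_sideKernel a b s (β - 1) x n
      have h := (hfg _ hh).sub_const (∫ t in Ioo a b, g t * min (sideKernel s (β - 1) x t) n)
      rw [sub_self] at h
      have h' := h.abs
      rw [abs_zero] at h'
      refine h'.congr fun k => ?_
      rw [← integral_sub (integrable_bdd_mul (hf k) hh) (integrable_bdd_mul hg hh)]
      simp only [Pi.sub_apply, sub_mul]
  rw [Metric.tendsto_atTop]
  intro ε hε
  have hδ := ((tendsto_integral_cutKernelExcess hr (b - a)).mul_const B')
  rw [zero_mul] at hδ
  obtain ⟨n, hn⟩ := (hδ.eventually_lt_const (half_pos hε)).exists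
  obtain ⟨N, hN⟩ := eventually_atTop.1 ((hmain n).eventually_lt_const (half_pos hε))
  refine ⟨N, fun k hk => ?_⟩
  rw [Real.dist_0_eq_abs, abs_of_nonneg (integral_nonneg fun x => abs_nonneg _)]
  have h1 := integral_abs_sideInt_le hβ s n ((hf k).sub hg)
  have h2 := mul_le_mul_of_nonneg_left (hd k)
    (integral_nonneg (μ := volume) (f := cutKernelExcess (β - 1) (b - a) n) fun y =>
      cutKernelExcess_nonneg _ _ _ y)
  have h3 := hN k hk
  linarith

/-- Weak convergence of functions and of their weak fractional derivatives implies strong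
convergence of the functions. -/
theorem tendsto_integral_abs_sub_of_isWeakFracDeriv {a b α : ℝ} (hab : a < b)
    (hα : α ∈ Ioo (0 : ℝ) 1) {s : Side} {u g : ℕ → ℝ → ℝ} {v f : ℝ → ℝ}
    (hu : ∀ k, IntegrableOn (u k) (Ioo a b)) (hv : IntegrableOn v (Ioo a b))
    (hg : ∀ k, IntegrableOn (g k) (Ioo a b)) (hf : IntegrableOn f (Ioo a b))
    (hug : ∀ k, IsWeakFracDeriv a b α s (u k) (g k)) (hvf : IsWeakFracDeriv a b α s v f)
    (huv : TendstoWeakly (volume.restrict (Ioo a b)) u v) (hgf : TendstoWeakly (volume.restrict (Ioo a b)) g f)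
    {B : ℝ} (hB : ∀ k, ∫ x in Ioo a b, |g k x| ≤ B) :
    Tendsto (fun k => ∫ x in Ioo a b, |u k x - v x|) atTop (𝓝 0) := by
  choose c hc using fun k => (hug k).exists_ae_eq hab hα (hu k) (hg k)
  obtain ⟨d, hd⟩ := hvf.exists_ae_eq hab hα hv hf
  set κ := (ProbabilityTheory.beta (1 - α) α)⁻¹ * Real.Gamma (1 - α)
  have hr : -1 < α - 1 := by linarith [hα.1]
  have he := integrableOn_base_rpow a b hr s
  have hE := integral_base_rpow_pos hab hr s
  set E := ∫ x in Ioo a b, |x - s.base a b| ^ (α - 1)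
  have hJ := fun k => integrable_sideInt hα.1 s (hg k)
  have hJf := integrable_sideInt hα.1 s hf
  have hJlim := tendsto_integral_abs_sideInt_sub hα.1 s hg hf hgf hB
  have hJlim' : Tendsto (fun k => ∫ x in Ioo a b, sideInt a b s α (g k) x) atTop
      (𝓝 (∫ x in Ioo a b, sideInt a b s α f x)) := by
    rw [tendsto_iff_norm_sub_tendsto_zero]
    refine squeeze_zero (fun k => norm_nonneg _) (fun k => ?_) hJlim
    rw [← integral_sub (hJ k) hJf]
    exact norm_integral_le_integral_norm _
  have hulim : Tendsto (fun k => ∫ x in Ioo a b, u k x) atTop (𝓝 (∫ x in Ioo a b, v x)) := by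
    simpa using huv (fun _ => 1) (memLp_top_const 1)
  -- Integrating the representation over (a, b) and dividing by E > 0 expresses the coefficient
  -- through ∫ u_k, which converges by testing with 1, and the convergent integral term.
  have hcE : ∀ k, c k = E⁻¹ * ((∫ x in Ioo a b, u k x) -
      κ * ∫ x in Ioo a b, sideInt a b s α (g k) x) := by
    intro k
    rw [integral_congr_ae (hc k), integral_add (he.const_mul _) ((hJ k).const_mul _),
      integral_const_mul, integral_const_mul, add_sub_cancel_right, mul_comm (c k),
      inv_mul_cancel_left₀ hE.ne']
  have hdE : d = E⁻¹ * ((∫ x in Ioo a b, v x) - κ * ∫ x in Ioo a b, sideInt a b s α f x) := by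
    rw [integral_congr_ae hd, integral_add (he.const_mul _) (hJf.const_mul _),
      integral_const_mul, integral_const_mul, add_sub_cancel_right, mul_comm d,
      inv_mul_cancel_left₀ hE.ne']
  have hclim : Tendsto c atTop (𝓝 d) := by
    rw [hdE, show c = _ from funext hcE]
    exact (hulim.sub (hJlim'.const_mul κ)).const_mul _
  have hlim : Tendsto (fun k => |c k - d| * E + |κ| * ∫ x in Ioo a b,
      |sideInt a b s α (g k) x - sideInt a b s α f x|) atTop (𝓝 0) := by
    have h1 := (hclim.sub_const d).abs
    rw [sub_self, abs_zero] at h1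
    simpa using (h1.mul_const E).add (hJlim.const_mul |κ|)
  refine squeeze_zero (fun k => integral_nonneg fun x => abs_nonneg _) (fun k => ?_) hlim
  have hJk : IntegrableOn (fun x => |sideInt a b s α (g k) x - sideInt a b s α f x|) (Ioo a b) :=
    ((hJ k).sub hJf).abs
  rw [← integral_const_mul, ← integral_const_mul,
    ← integral_add (he.const_mul _) (hJk.const_mul _)]
  refine integral_mono_ae ((hu k).sub hv).abs
    ((he.const_mul _).add (hJk.const_mul _)) ?_
  filter_upwards [hc k, hd] with x h1 h2
  rw [h1, h2]
  have h3 : (0 : ℝ) ≤ |x - s.base a b| ^ (α - 1) := by positivity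
  calc _ = |(c k - d) * |x - s.base a b| ^ (α - 1) +
        κ * (sideInt a b s α (g k) x - sideInt a b s α f x)| := by congr 1; ring
    _ ≤ _ := (abs_add_le _ _).trans_eq (by rw [abs_mul, abs_mul, abs_of_nonneg h3])

/-! ### Affine lower bounds in the limit: Egorov and Fatou -/

section Weak

variable {X : Type*} [MeasurableSpace X] {μ : Measure X}

theorem memLp_top_restrict_of_tendstoUniformlyOn {A : Set X} (hA : MeasurableSet A)
    {H : ℕ → X → ℝ} {G : X → ℝ} (hH : ∀ k, AEStronglyMeasurable (H k) μ)
    (hHG : TendstoUniformlyOn H G atTop A) {R : ℝ} (hR : ∀ x ∈ A, |G x| ≤ R) :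
    ∀ᶠ k in atTop, MemLp (H k) ⊤ (μ.restrict A) := by
  filter_upwards [Metric.tendstoUniformlyOn_iff.1 hHG 1 one_pos] with k hk
  refine memLp_top_of_bound (hH k).restrict (R + 1) ((ae_restrict_iff' hA).2 (ae_of_all _ ?_))
  intro x hx
  have h1 := hk x hx
  rw [Real.dist_eq, abs_sub_comm] at h1
  rw [Real.norm_eq_abs]
  calc |H k x| = |G x + (H k x - G x)| := by congr 1; ring
    _ ≤ |G x| + |H k x - G x| := abs_add_le _ _
    _ ≤ R + 1 := add_le_add (hR x hx) h1.le

/-- The factor H k is split as G + (H k - G). The first part tends to zero because G cut off to A is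
a bounded test function, the second because uniform smallness meets the L¹ bound on p k - q. -/
theorem tendsto_setIntegral_mul_sub [IsFiniteMeasure μ] {A : Set X} (hA : MeasurableSet A)
    {H : ℕ → X → ℝ} {G : X → ℝ} (hH : ∀ k, AEStronglyMeasurable (H k) μ)
    (hG : AEStronglyMeasurable G μ)
    (hHG : TendstoUniformlyOn H G atTop A) {R : ℝ} (hR : ∀ x ∈ A, |G x| ≤ R)
    {p : ℕ → X → ℝ} {q : X → ℝ} (hp : ∀ k, Integrable (p k) μ) (hq : Integrable q μ)
    (hpq : TendstoWeakly μ p q) {B : ℝ} (hB : ∀ k, ∫ x, |p k x| ∂μ ≤ B) :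
    Tendsto (fun k => ∫ x in A, H k x * (p k x - q x) ∂μ) atTop (𝓝 0) := by
  have hGA : MemLp G ⊤ (μ.restrict A) :=
    memLp_top_of_bound hG.restrict R ((ae_restrict_iff' hA).2 (ae_of_all _ hR))
  have hd : ∀ k, Integrable (fun x => p k x - q x) μ := fun k => (hp k).sub hq
  have h1 : Tendsto (fun k => ∫ x in A, G x * (p k x - q x) ∂μ) atTop (𝓝 0) := by
    have hGi : MemLp (A.indicator G) ⊤ μ := (memLp_indicator_iff_restrict hA).2 hGA
    have h := (hpq _ hGi).sub_const (∫ x, q x * A.indicator G x ∂μ)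
    rw [sub_self] at h
    refine h.congr fun k => ?_
    have i1 : Integrable (fun x => p k x * A.indicator G x) μ :=
      Integrable.mul_of_top_left (hp k) hGi
    have i2 : Integrable (fun x => q x * A.indicator G x) μ := Integrable.mul_of_top_left hq hGi
    rw [← integral_sub i1 i2, ← integral_indicator hA]
    congr 1
    funext x
    by_cases hx : x ∈ A
    · simp only [indicator_of_mem hx]; ring
    · simp only [indicator_of_notMem hx]; ring
  set B' := B + ∫ x, |q x| ∂μ
  have hdB : ∀ k, ∫ x in A, |p k x - q x| ∂μ ≤ B' := by
    intro k
    calc ∫ x in A, |p k x - q x| ∂μ ≤ ∫ x, |p k x - q x| ∂μ :=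
          setIntegral_le_integral (hd k).abs (ae_of_all _ fun x => abs_nonneg _)
      _ ≤ ∫ x, (|p k x| + |q x|) ∂μ :=
          integral_mono (hd k).abs ((hp k).abs.add hq.abs) fun x => abs_sub _ _
      _ ≤ B' := by
          rw [integral_add (hp k).abs hq.abs]
          exact add_le_add_left (hB k) _
  have hB0 : 0 ≤ B' := (integral_nonneg fun x => abs_nonneg _).trans (hdB 0)
  have h2 : Tendsto (fun k => ∫ x in A, (H k x - G x) * (p k x - q x) ∂μ) atTop (𝓝 0) := by
    rw [Metric.tendsto_atTop']
    intro ε hε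
    -- The summand 1 keeps the denominator positive when B' = 0.
    obtain ⟨N, hN⟩ := eventually_atTop.1
      (Metric.tendstoUniformlyOn_iff.1 hHG (ε / (B' + 1)) (by positivity))
    refine ⟨N, fun k hk => ?_⟩
    rw [dist_zero_right]
    have hle : ‖∫ x in A, (H k x - G x) * (p k x - q x) ∂μ‖ ≤
        ∫ x in A, ε / (B' + 1) * |p k x - q x| ∂μ := by
      refine norm_integral_le_of_norm_le ((hd k).abs.restrict.const_mul _)
        ((ae_restrict_iff' hA).2 (ae_of_all _ fun x hx => ?_))
      have h3 := hN k hk.le x hx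
      rw [Real.dist_eq, abs_sub_comm] at h3
      rw [norm_mul, Real.norm_eq_abs, Real.norm_eq_abs]
      exact mul_le_mul_of_nonneg_right h3.le (abs_nonneg _)
    rw [integral_const_mul] at hle
    refine hle.trans_lt ?_
    calc ε / (B' + 1) * ∫ x in A, |p k x - q x| ∂μ ≤ ε / (B' + 1) * B' :=
          mul_le_mul_of_nonneg_left (hdB k) (by positivity)
      _ < ε / (B' + 1) * (B' + 1) := mul_lt_mul_of_pos_left (by linarith) (by positivity)
      _ = ε := by field_simp
  have h3 := h1.add h2
  rw [add_zero] at h3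
  refine h3.congr' ?_
  filter_upwards [memLp_top_restrict_of_tendstoUniformlyOn hA hH hHG hR] with k hk
  have hdA : Integrable (fun x => p k x - q x) (μ.restrict A) := (hd k).restrict
  have i1 : Integrable (fun x => G x * (p k x - q x)) (μ.restrict A) :=
    Integrable.mul_of_top_right hdA hGA
  have i2 : Integrable (fun x => (H k x - G x) * (p k x - q x)) (μ.restrict A) :=
    Integrable.mul_of_top_right hdA (hk.sub hGA)
  rw [← integral_add i1 i2]
  congr 1
  funext x
  ring

theorem tendsto_setIntegral_of_tendstoUniformlyOn [IsFiniteMeasure μ] {A : Set X}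
    (hA : MeasurableSet A)
    {H : ℕ → X → ℝ} {G : X → ℝ} (hH : ∀ k, AEStronglyMeasurable (H k) μ)
    (hHG : TendstoUniformlyOn H G atTop A) {R : ℝ} (hR : ∀ x ∈ A, |G x| ≤ R) :
    Tendsto (fun k => ∫ x in A, H k x ∂μ) atTop (𝓝 (∫ x in A, G x ∂μ)) := by
  refine tendsto_integral_filter_of_dominated_convergence (fun _ => R + 1)
    (Eventually.of_forall fun k => (hH k).restrict) ?_ (integrable_const _)
    ((ae_restrict_iff' hA).2 (ae_of_all _ fun x hx => hHG.tendsto_at hx))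
  filter_upwards [Metric.tendstoUniformlyOn_iff.1 hHG 1 one_pos] with k hk
  refine (ae_restrict_iff' hA).2 (ae_of_all _ fun x hx => ?_)
  have h1 := hk x hx
  rw [Real.dist_eq, abs_sub_comm] at h1
  rw [Real.norm_eq_abs]
  calc |H k x| = |G x + (H k x - G x)| := by congr 1; ring
    _ ≤ |G x| + |H k x - G x| := abs_add_le _ _
    _ ≤ R + 1 := add_le_add (hR x hx) h1.le

theorem ofReal_integral_le_lintegral_ofReal {f : X → ℝ} (hf : Integrable f μ) :
    ENNReal.ofReal (∫ x, f x ∂μ) ≤ ∫⁻ x, ENNReal.ofReal (f x) ∂μ := by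
  rw [integral_eq_lintegral_pos_part_sub_lintegral_neg_part hf]
  exact (ENNReal.ofReal_le_ofReal (sub_le_self _ ENNReal.toReal_nonneg)).trans
    ENNReal.ofReal_toReal_le

/-- Egorov's theorem with boundedness of the limit. -/
theorem exists_tendstoUniformlyOn_and_bounded [IsFiniteMeasure μ] {E : Type*}
    [NormedAddCommGroup E] {H : ℕ → X → E} {G : X → E}
    (hH : ∀ k, AEStronglyMeasurable (H k) μ) (hG : AEStronglyMeasurable G μ)
    (h : ∀ᵐ x ∂μ, Tendsto (fun k => H k x) atTop (𝓝 (G x))) :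
    ∃ A : ℕ → Set X, (∀ n, MeasurableSet (A n)) ∧ (∀ n, TendstoUniformlyOn H G atTop (A n)) ∧
      (∀ n, ∃ R : ℝ, ∀ x ∈ A n, ‖G x‖ ≤ R) ∧ ∀ᵐ x ∂μ, ∀ᶠ n in atTop, x ∈ A n := by
  -- a null set outside of which all functions are measurable
  obtain ⟨Z, hZ, hZm, hZ0⟩ : ∃ Z : Set X, (∀ x ∉ Z, (∀ k, H k x = (hH k).mk _ x) ∧
      G x = hG.mk _ x) ∧ MeasurableSet Z ∧ μ Z = 0 := by
    have hae : ∀ᵐ x ∂μ, (∀ k, H k x = (hH k).mk _ x) ∧ G x = hG.mk _ x :=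
      (ae_all_iff.2 fun k => (hH k).ae_eq_mk).and hG.ae_eq_mk
    obtain ⟨Z, h1, h2, h3⟩ := exists_measurable_superset_of_null hae
    exact ⟨Z, fun x hx => by by_contra hn; exact hx (h1 hn), h2, h3⟩
  have hZae : ∀ᵐ x ∂μ, x ∉ Z := measure_eq_zero_iff_ae_notMem.1 hZ0
  have h' : ∀ᵐ x ∂μ, Tendsto (fun k => (hH k).mk _ x) atTop (𝓝 (hG.mk _ x)) := by
    filter_upwards [h, hZae] with x h1 h2
    rw [← (hZ x h2).2]
    exact h1.congr fun k => (hZ x h2).1 k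
  -- Exceptional sets of measure at most 2⁻ⁿ have summable measures, so by Borel–Cantelli almost
  -- every point lies in only finitely many of them.
  choose T hTm hTμ hT using fun n : ℕ => tendstoUniformlyOn_of_ae_tendsto'
    (fun k => (hH k).stronglyMeasurable_mk) hG.stronglyMeasurable_mk h'
    (ε := (1 / 2) ^ n) (by positivity)
  have hBC : ∀ᵐ x ∂μ, ∀ᶠ n in atTop, x ∉ T n := by
    refine ae_eventually_notMem (ne_top_of_le_ne_top ?_ (ENNReal.tsum_le_tsum hTμ))
    rw [← ENNReal.ofReal_tsum_of_nonneg (fun n => by positivity) summable_geometric_two]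
    exact ENNReal.ofReal_ne_top
  refine ⟨fun n => (T n)ᶜ ∩ Zᶜ ∩ {x | ‖hG.mk _ x‖ ≤ n}, fun n => ?_, fun n => ?_, fun n => ?_, ?_⟩
  · exact ((hTm n).compl.inter hZm.compl).inter
      (measurableSet_le hG.stronglyMeasurable_mk.norm.measurable measurable_const)
  · refine ((hT n).mono (fun x hx => hx.1.1)).congr (Eventually.of_forall fun k x hx => ?_)
      |>.congr_right fun x hx => ?_
    · exact ((hZ x hx.1.2).1 k).symm
    · exact ((hZ x hx.1.2).2).symm
  · exact ⟨n, fun x hx => by rw [(hZ x hx.1.2).2]; exact hx.2⟩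
  · filter_upwards [hBC, hZae] with x h1 h2
    obtain ⟨N, hN⟩ := exists_nat_ge ‖hG.mk _ x‖
    filter_upwards [h1, eventually_ge_atTop N] with n h3 h4
    exact ⟨⟨h3, h2⟩, hN.trans (by exact_mod_cast h4)⟩

/-- The integral bound passes to the limit when the integrands `W k` are bounded below by
affine functions of weakly convergent sequences with almost everywhere convergent coefficients. -/
theorem lintegral_le_of_forall_affine_le [IsFiniteMeasure μ]
    {F₀ F₁ F₂ p q : X → ℝ} {G₀ G₁ G₂ P Q W : ℕ → X → ℝ}
    (hG₀ : ∀ k, AEStronglyMeasurable (G₀ k) μ) (hG₁ : ∀ k, AEStronglyMeasurable (G₁ k) μ)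
    (hG₂ : ∀ k, AEStronglyMeasurable (G₂ k) μ) (hF₀ : AEStronglyMeasurable F₀ μ)
    (hF₁ : AEStronglyMeasurable F₁ μ) (hF₂ : AEStronglyMeasurable F₂ μ)
    (h₀ : ∀ᵐ x ∂μ, Tendsto (fun k => G₀ k x) atTop (𝓝 (F₀ x)))
    (h₁ : ∀ᵐ x ∂μ, Tendsto (fun k => G₁ k x) atTop (𝓝 (F₁ x)))
    (h₂ : ∀ᵐ x ∂μ, Tendsto (fun k => G₂ k x) atTop (𝓝 (F₂ x)))
    (hP : ∀ k, Integrable (P k) μ) (hp : Integrable p μ) (hPp : TendstoWeakly μ P p)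
    (hQ : ∀ k, Integrable (Q k) μ) (hq : Integrable q μ) (hQq : TendstoWeakly μ Q q)
    {B B' : ℝ} (hB : ∀ k, ∫ x, |P k x| ∂μ ≤ B) (hB' : ∀ k, ∫ x, |Q k x| ∂μ ≤ B')
    (hF₀n : 0 ≤ᵐ[μ] F₀)
    (hW : ∀ k, ∀ᵐ x ∂μ, G₀ k x + (G₁ k x * (P k x - p x) + G₂ k x * (Q k x - q x)) ≤ W k x)
    {c : ℝ≥0∞} (hc : ∀ k, ∫⁻ x, ENNReal.ofReal (W k x) ∂μ ≤ c) :
    ∫⁻ x, ENNReal.ofReal (F₀ x) ∂μ ≤ c := by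
  -- Applied to the triple, so that the same sets serve the constant term and both slopes.
  obtain ⟨A, hAm, hAu, hAb, hA⟩ := exists_tendstoUniformlyOn_and_bounded
    (H := fun k x => (G₀ k x, G₁ k x, G₂ k x)) (G := fun x => (F₀ x, F₁ x, F₂ x))
    (fun k => (hG₀ k).prodMk ((hG₁ k).prodMk (hG₂ k))) (hF₀.prodMk (hF₁.prodMk hF₂)) (by
      filter_upwards [h₀, h₁, h₂] with x h0 h1 h2
      exact h0.prodMk_nhds (h1.prodMk_nhds h2))
  -- On A n the integrals of the affine lower bounds converge to that of F₀, the slope terms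
  -- vanishing. After `ENNReal.ofReal` the integral of W k over A n is at most the one over the
  -- whole space.
  have hset : ∀ n, ∫⁻ x in A n, ENNReal.ofReal (F₀ x) ∂μ ≤ c := by
    intro n
    obtain ⟨R, hR⟩ := hAb n
    have hu := Metric.tendstoUniformlyOn_iff.1 (hAu n)
    have u0 : TendstoUniformlyOn G₀ F₀ atTop (A n) :=
      Metric.tendstoUniformlyOn_iff.2 fun ε hε => (hu ε hε).mono fun k hk x hx =>
        (le_max_left _ _).trans_lt (hk x hx)
    have u1 : TendstoUniformlyOn G₁ F₁ atTop (A n) :=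
      Metric.tendstoUniformlyOn_iff.2 fun ε hε => (hu ε hε).mono fun k hk x hx =>
        ((le_max_left _ _).trans (le_max_right _ _)).trans_lt (hk x hx)
    have u2 : TendstoUniformlyOn G₂ F₂ atTop (A n) :=
      Metric.tendstoUniformlyOn_iff.2 fun ε hε => (hu ε hε).mono fun k hk x hx =>
        ((le_max_right _ _).trans (le_max_right _ _)).trans_lt (hk x hx)
    have b0 : ∀ x ∈ A n, |F₀ x| ≤ R := fun x hx => (norm_fst_le _).trans (hR x hx)
    have b1 : ∀ x ∈ A n, |F₁ x| ≤ R := fun x hx =>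
      (norm_fst_le _).trans ((norm_snd_le _).trans (hR x hx))
    have b2 : ∀ x ∈ A n, |F₂ x| ≤ R := fun x hx =>
      (norm_snd_le _).trans ((norm_snd_le _).trans (hR x hx))
    have t0 := tendsto_setIntegral_of_tendstoUniformlyOn (hAm n) hG₀ u0 b0
    have t1 := tendsto_setIntegral_mul_sub (hAm n) hG₁ hF₁ u1 b1 hP hp hPp hB
    have t2 := tendsto_setIntegral_mul_sub (hAm n) hG₂ hF₂ u2 b2 hQ hq hQq hB'
    have t := t0.add (t1.add t2)
    rw [add_zero, add_zero] at t
    have hFi : Integrable F₀ (μ.restrict (A n)) :=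
      (memLp_top_of_bound hF₀.restrict R
        ((ae_restrict_iff' (hAm n)).2 (ae_of_all _ b0))).integrable le_top
    rw [← ofReal_integral_eq_lintegral_ofReal hFi (ae_restrict_of_ae hF₀n)]
    refine le_of_tendsto ((ENNReal.continuous_ofReal.tendsto _).comp t) ?_
    filter_upwards [memLp_top_restrict_of_tendstoUniformlyOn (hAm n) hG₀ u0 b0,
      memLp_top_restrict_of_tendstoUniformlyOn (hAm n) hG₁ u1 b1,
      memLp_top_restrict_of_tendstoUniformlyOn (hAm n) hG₂ u2 b2] with k m0 m1 m2
    have i0 : Integrable (G₀ k) (μ.restrict (A n)) := m0.integrable le_top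
    have i1 : Integrable (fun x => G₁ k x * (P k x - p x)) (μ.restrict (A n)) :=
      Integrable.mul_of_top_right ((hP k).sub hp).restrict m1
    have i2 : Integrable (fun x => G₂ k x * (Q k x - q x)) (μ.restrict (A n)) :=
      Integrable.mul_of_top_right ((hQ k).sub hq).restrict m2
    have i12 : Integrable (fun x => G₁ k x * (P k x - p x) + G₂ k x * (Q k x - q x))
      (μ.restrict (A n)) := i1.add i2
    simp only [Function.comp_apply]
    rw [← integral_add i1 i2, ← integral_add i0 i12]
    calc _ ≤ _ := ofReal_integral_le_lintegral_ofReal (i0.add i12)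
      _ ≤ ∫⁻ x in A n, ENNReal.ofReal (W k x) ∂μ :=
          lintegral_mono_ae ((ae_restrict_of_ae (hW k)).mono fun x hx =>
            ENNReal.ofReal_le_ofReal hx)
      _ ≤ ∫⁻ x, ENNReal.ofReal (W k x) ∂μ := setLIntegral_le_lintegral _ _
      _ ≤ c := hc k
  -- The sets A n need not be nested, so Fatou's lemma takes the place of monotone convergence.
  calc ∫⁻ x, ENNReal.ofReal (F₀ x) ∂μ
      ≤ ∫⁻ x, liminf (fun n => (A n).indicator (fun x => ENNReal.ofReal (F₀ x)) x) atTop ∂μ := by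
        refine lintegral_mono_ae ?_
        filter_upwards [hA] with x hx
        refine le_liminf_of_le (by isBoundedDefault) ?_
        filter_upwards [hx] with n hn
        rw [indicator_of_mem hn]
    _ ≤ liminf (fun n => ∫⁻ x, (A n).indicator (fun x => ENNReal.ofReal (F₀ x)) x ∂μ) atTop :=
        lintegral_liminf_le' fun n => hF₀.aemeasurable.ennreal_ofReal.indicator (hAm n)
    _ ≤ c := by
        refine liminf_le_of_frequently_le' (Eventually.of_forall fun n => ?_).frequently
        rw [lintegral_indicator (hAm n)]
        exact hset n

end Weak

/-! ### From the weak topology to weak limits in L¹ -/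

section WeakLimit

variable {X : Type*} [MeasurableSpace X] {μ : Measure X}

/-- The functions `f k` form a bounded sequence in `L¹` and converge against all bounded functions
to the integrable function `g`. -/
structure IsWeakL1Limit (μ : Measure X) (f : ℕ → X → ℝ) (g : X → ℝ) : Prop where
  integrable : ∀ k, Integrable (f k) μ
  integrable_limit : Integrable g μ
  tendsto : TendstoWeakly μ f g
  bounded : ∃ B, ∀ k, ∫ x, |f k x| ∂μ ≤ B

/-- Stands in for the derivative that the integrand does not see when θ is 0 or 1. -/
theorem IsWeakL1Limit.zero (μ : Measure X) : IsWeakL1Limit μ (fun _ _ => 0) fun _ => 0 :=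
  ⟨fun _ => integrable_zero _ _ _, integrable_zero _ _ _, fun _ _ => by simp, 0, by simp⟩

theorem IsWeakL1Limit.comp {f : ℕ → X → ℝ} {g : X → ℝ} (h : IsWeakL1Limit μ f g) {n : ℕ → ℕ}
    (hn : Tendsto n atTop atTop) : IsWeakL1Limit μ (fun k => f (n k)) g := by
  obtain ⟨B, hB⟩ := h.bounded
  exact ⟨fun k => h.integrable _, h.integrable_limit, fun φ hφ => (h.tendsto φ hφ).comp hn, B,
    fun k => hB _⟩

theorem IsWeakL1Limit.congr {f f' : ℕ → X → ℝ} {g g' : X → ℝ} (h : IsWeakL1Limit μ f g)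
    (hf : ∀ k, f k =ᵐ[μ] f' k) (hg : g =ᵐ[μ] g') : IsWeakL1Limit μ f' g' := by
  obtain ⟨B, hB⟩ := h.bounded
  refine ⟨fun k => (h.integrable k).congr (hf k), h.integrable_limit.congr hg, fun φ hφ => ?_, B,
    fun k => ?_⟩
  · have e : ∀ {f g : X → ℝ}, f =ᵐ[μ] g → ∫ x, f x * φ x ∂μ = ∫ x, g x * φ x ∂μ := fun h =>
      integral_congr_ae (h.mono fun x hx => by simp only [hx])
    rw [← e hg]
    exact (h.tendsto φ hφ).congr fun k => e (hf k)
  · refine le_of_eq_of_le (integral_congr_ae ((hf k).mono fun x hx => ?_)) (hB k)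
    simp only [hx]

/-- On a finite measure space a bounded function lies in the conjugate space, and Hölder's
inequality makes the pairing continuous. -/
theorem exists_clm_eq_integral_mul [IsFiniteMeasure μ] (p : ℝ≥0∞) [Fact (1 ≤ p)] {h : X → ℝ}
    (hh : MemLp h ⊤ μ) :
    ∃ ℓ : StrongDual ℝ (Lp ℝ p μ), ∀ f : Lp ℝ p μ, ℓ f = ∫ x, f x * h x ∂μ := by
  have hq : Fact (1 ≤ ENNReal.conjExponent p) := ⟨by simp [ENNReal.conjExponent]⟩
  have hh' : MemLp h (ENNReal.conjExponent p) μ := hh.mono_exponent le_top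
  refine ⟨((ContinuousLinearMap.mul ℝ ℝ).lpPairing μ p (ENNReal.conjExponent p)).flip hh'.toLp,
    fun f => ?_⟩
  rw [ContinuousLinearMap.flip_apply, ContinuousLinearMap.lpPairing_eq_integral]
  refine integral_congr_ae ?_
  filter_upwards [hh'.coeFn_toLp] with x hx
  rw [hx]; rfl

theorem tendsto_apply_of_tendsto_toWeakSpace {E : Type*} [NormedAddCommGroup E] [NormedSpace ℝ E]
    {v : ℕ → E} {w : E}
    (h : Tendsto (fun k => toWeakSpace ℝ E (v k)) atTop (𝓝 (toWeakSpace ℝ E w)))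
    (ℓ : StrongDual ℝ E) : Tendsto (fun k => ℓ (v k)) atTop (𝓝 (ℓ w)) :=
  ((WeakBilin.eval_continuous (topDualPairing ℝ E).flip ℓ).tendsto (toWeakSpace ℝ E w)).comp h

/-- Uniform boundedness for the evaluations on the dual. Only the dual has to be complete, so
completeness of the fractional spaces is not needed. -/
theorem exists_norm_le_of_tendsto_toWeakSpace {E : Type*} [NormedAddCommGroup E]
    [NormedSpace ℝ E] {v : ℕ → E} {w : E}
    (h : Tendsto (fun k => toWeakSpace ℝ E (v k)) atTop (𝓝 (toWeakSpace ℝ E w))) :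
    ∃ C, ∀ k, ‖v k‖ ≤ C := by
  obtain ⟨C, hC⟩ := banach_steinhaus (g := fun k => NormedSpace.inclusionInDoubleDual ℝ E (v k))
    fun ℓ => by
      obtain ⟨C, hC⟩ := (tendsto_apply_of_tendsto_toWeakSpace h ℓ).norm.bddAbove_range
      exact ⟨C, fun k => hC ⟨k, rfl⟩⟩
  refine ⟨C, fun k => ?_⟩
  have e : ‖NormedSpace.inclusionInDoubleDual ℝ E (v k)‖ = ‖v k‖ :=
    (NormedSpace.inclusionInDoubleDualLi ℝ (E := E)).norm_map (v k)
  rw [← e]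
  exact hC k

theorem exists_integral_abs_le_mul_norm [IsFiniteMeasure μ] (p : ℝ≥0∞) [hp : Fact (1 ≤ p)] :
    ∃ K : ℝ, 0 ≤ K ∧ ∀ f : Lp ℝ p μ, ∫ x, |f x| ∂μ ≤ K * ‖f‖ := by
  refine ⟨(μ univ ^ (1 / (1 : ℝ≥0∞).toReal - 1 / p.toReal)).toReal, ENNReal.toReal_nonneg,
    fun f => ?_⟩
  have h := eLpNorm_le_eLpNorm_mul_rpow_measure_univ (μ := μ) hp.out (Lp.aestronglyMeasurable f)
  have hexp : 0 ≤ 1 / (1 : ℝ≥0∞).toReal - 1 / p.toReal := by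
    rcases eq_or_ne p ⊤ with rfl | hpt
    · simp
    · have : 1 ≤ p.toReal := by
        rw [← ENNReal.toReal_one]; exact ENNReal.toReal_mono hpt hp.out
      rw [ENNReal.toReal_one, div_one, sub_nonneg, div_le_one (by linarith)]
      exact this
  have hfin : μ univ ^ (1 / (1 : ℝ≥0∞).toReal - 1 / p.toReal) ≠ ⊤ :=
    ENNReal.rpow_ne_top_of_nonneg hexp (measure_ne_top μ univ)
  have h1 : ∫ x, |f x| ∂μ = (eLpNorm f 1 μ).toReal := by
    simp only [← Real.norm_eq_abs]
    rw [eLpNorm_one_eq_lintegral_enorm, integral_norm_eq_lintegral_enorm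
      (Lp.aestronglyMeasurable f)]
  rw [h1, Lp.norm_def, mul_comm, ← ENNReal.toReal_mul]
  exact ENNReal.toReal_mono (ENNReal.mul_ne_top (Lp.eLpNorm_ne_top f) hfin) h

/-- Pairing with a bounded function after T is a continuous functional on E; the L¹ bound comes from
boundedness of weakly convergent sequences. -/
theorem isWeakL1Limit_of_tendsto_toWeakSpace [IsFiniteMeasure μ] {E : Type*}
    [NormedAddCommGroup E] [NormedSpace ℝ E] {p : ℝ≥0∞} [hp : Fact (1 ≤ p)]
    (T : E →L[ℝ] Lp ℝ p μ) {v : ℕ → E} {w : E}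
    (h : Tendsto (fun k => toWeakSpace ℝ E (v k)) atTop (𝓝 (toWeakSpace ℝ E w))) :
    IsWeakL1Limit μ (fun k => T (v k)) (T w) := by
  refine ⟨fun k => (Lp.memLp _).integrable hp.out, (Lp.memLp _).integrable hp.out,
    fun φ hφ => ?_, ?_⟩
  · obtain ⟨ℓ, hℓ⟩ := exists_clm_eq_integral_mul p hφ
    simp only [← hℓ]
    exact tendsto_apply_of_tendsto_toWeakSpace h (ℓ.comp T)
  · obtain ⟨C, hC⟩ := exists_norm_le_of_tendsto_toWeakSpace h
    obtain ⟨K, hK0, hK⟩ := exists_integral_abs_le_mul_norm (μ := μ) p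
    refine ⟨K * (‖T‖ * C), fun k => (hK _).trans (mul_le_mul_of_nonneg_left ?_ hK0)⟩
    exact (T.le_opNorm _).trans (mul_le_mul_of_nonneg_left (hC k) (norm_nonneg _))

/-- A sequence converging in `L¹` has a subsequence converging almost everywhere. -/
theorem exists_strictMono_tendsto_ae {f : ℕ → X → ℝ} {g : X → ℝ} (hf : ∀ k, Integrable (f k) μ)
    (hg : Integrable g μ) (h : Tendsto (fun k => ∫ x, |f k x - g x| ∂μ) atTop (𝓝 0)) :
    ∃ n : ℕ → ℕ, StrictMono n ∧ ∀ᵐ x ∂μ, Tendsto (fun k => f (n k) x) atTop (𝓝 (g x)) := by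
  refine (tendstoInMeasure_of_tendsto_eLpNorm (p := 1) one_ne_zero
    (fun k => (hf k).aestronglyMeasurable) hg.aestronglyMeasurable ?_).exists_seq_tendsto_ae
  have e : ∀ k, eLpNorm (f k - g) 1 μ = ENNReal.ofReal (∫ x, |f k x - g x| ∂μ) := by
    intro k
    rw [eLpNorm_one_eq_lintegral_enorm, ← ofReal_integral_norm_eq_lintegral_enorm ((hf k).sub hg)]
    rfl
  simp only [e]
  have h' := (ENNReal.continuous_ofReal.tendsto 0).comp h
  rwa [ENNReal.ofReal_zero] at h'

end WeakLimit

/-! ### Weak convergence in the fractional Sobolev spaces -/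

namespace FracSpace

variable {a b : ℝ} {hab : a < b} {α : ℝ} {hα : α ∈ Ioo (0 : ℝ) 1} {p : ℝ≥0∞} [Fact (1 ≤ p)]
  {θ lam : ℝ}

/-- The condition `hs` singles out the sides whose derivative the norm controls for the given θ. In
the symmetric case each one-sided norm is a component of an ℓ^p product. -/
theorem norm_oneSidedGraph_le (s : Side) (hs : s = .left ∧ θ ≠ 1 ∨ s = .right ∧ θ ≠ 0)
    (u : FracSpace hab hα p θ lam) : ‖oneSidedGraph α s u.toLpI‖ ≤ ‖u‖ := by
  by_cases h0 : θ = 0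
  · rcases hs with ⟨rfl, -⟩ | ⟨-, h⟩
    · exact (if_pos h0 : ‖u‖ = oneSidedNorm α .left u.toLpI).ge
    · exact absurd h0 h
  by_cases h1 : θ = 1
  · rcases hs with ⟨-, h⟩ | ⟨rfl, -⟩
    · exact absurd h1 h
    · exact ((if_neg h0).trans (if_pos h1) : ‖u‖ = oneSidedNorm α .right u.toLpI).ge
  · have hn : ‖u‖ = symmNorm α u.toLpI := (if_neg h0).trans (if_neg h1)
    rw [hn, symmNorm]
    rcases hs with ⟨rfl, -⟩ | ⟨rfl, -⟩
    · exact WithLp.norm_fst_le _ (WithLp.toLp p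
        (oneSidedGraph α .left u.toLpI, oneSidedGraph α .right u.toLpI))
    · exact WithLp.norm_snd_le _ (WithLp.toLp p
        (oneSidedGraph α .left u.toLpI, oneSidedGraph α .right u.toLpI))

theorem mem_oneSidedSobolev (s : Side) (hs : s = .left ∧ θ ≠ 1 ∨ s = .right ∧ θ ≠ 0)
    (u : FracSpace hab hα p θ lam) : u.toLpI ∈ oneSidedSobolev a b hα p s := by
  rcases hs with ⟨rfl, h⟩ | ⟨rfl, h⟩
  · exact u.mem_left h
  · exact u.mem_right h

/-- The graph map into the `ℓ^p` product of two copies of `L^p`, as a continuous linear map. -/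
def graphCLM (s : Side) (hs : s = .left ∧ θ ≠ 1 ∨ s = .right ∧ θ ≠ 0) :
    FracSpace hab hα p θ lam →L[ℝ] WithLp p (LpI a b p × LpI a b p) :=
  LinearMap.mkContinuous
    { toFun := fun u => oneSidedGraph α s u.toLpI
      map_add' := fun u v =>
        oneSidedGraph_add hα (u.mem_oneSidedSobolev s hs) (v.mem_oneSidedSobolev s hs)
      map_smul' := fun c u => oneSidedGraph_smul hα c (u.mem_oneSidedSobolev s hs) }
    1 fun u => by rw [one_mul]; exact u.norm_oneSidedGraph_le s hs

theorem isWeakL1Limit_toLpI (s : Side) (hs : s = .left ∧ θ ≠ 1 ∨ s = .right ∧ θ ≠ 0)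
    {v : ℕ → FracSpace hab hα p θ lam} {w : FracSpace hab hα p θ lam}
    (h : Tendsto (fun k => toWeakSpace ℝ _ (v k)) atTop (𝓝 (toWeakSpace ℝ _ w))) :
    IsWeakL1Limit (volume.restrict (Ioo a b)) (fun k => (v k).toLpI) w.toLpI :=
  isWeakL1Limit_of_tendsto_toWeakSpace ((WithLp.fstL p ℝ _ _).comp (graphCLM s hs)) h

theorem weakFracDerivLp_coe_ae_eq (s : Side) {u : LpI a b p} (h : u ∈ oneSidedSobolev a b hα p s) :
    weakFracDerivLp α s u =ᵐ[volume.restrict (Ioo a b)] weakFracDeriv a b α s u := by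
  obtain ⟨g, hg, m⟩ := h
  rw [weakFracDerivLp_ae_eq hg m]
  exact m.coeFn_toLp.trans hg.weakFracDeriv_ae_eq.symm

theorem isWeakFracDeriv_weakFracDeriv (s : Side) {u : LpI a b p}
    (h : u ∈ oneSidedSobolev a b hα p s) :
    IsWeakFracDeriv a b α s u (weakFracDeriv a b α s u) := by
  have hex : ∃ g, IsWeakFracDeriv a b α s u g := ⟨h.choose, h.choose_spec.1⟩
  rw [weakFracDeriv, dif_pos hex]
  exact hex.choose_spec

theorem isWeakL1Limit_weakFracDeriv (s : Side) (hs : s = .left ∧ θ ≠ 1 ∨ s = .right ∧ θ ≠ 0)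
    {v : ℕ → FracSpace hab hα p θ lam} {w : FracSpace hab hα p θ lam}
    (h : Tendsto (fun k => toWeakSpace ℝ _ (v k)) atTop (𝓝 (toWeakSpace ℝ _ w))) :
    IsWeakL1Limit (volume.restrict (Ioo a b)) (fun k => weakFracDeriv a b α s (v k).toLpI)
      (weakFracDeriv a b α s w.toLpI) :=
  (isWeakL1Limit_of_tendsto_toWeakSpace ((WithLp.sndL p ℝ _ _).comp (graphCLM s hs)) h).congr
    (fun k => weakFracDerivLp_coe_ae_eq s ((v k).mem_oneSidedSobolev s hs))
    (weakFracDerivLp_coe_ae_eq s (w.mem_oneSidedSobolev s hs))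

/-- Weak convergence in the fractional Sobolev spaces implies strong convergence in `L¹`. -/
theorem tendsto_integral_abs_sub (s : Side) (hs : s = .left ∧ θ ≠ 1 ∨ s = .right ∧ θ ≠ 0)
    {v : ℕ → FracSpace hab hα p θ lam} {w : FracSpace hab hα p θ lam}
    (h : Tendsto (fun k => toWeakSpace ℝ _ (v k)) atTop (𝓝 (toWeakSpace ℝ _ w))) :
    Tendsto (fun k => ∫ x in Ioo a b, |(v k).toLpI x - w.toLpI x|) atTop (𝓝 0) := by
  have h1 := isWeakL1Limit_toLpI s hs h
  have h2 := isWeakL1Limit_weakFracDeriv s hs h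
  obtain ⟨B, hB⟩ := h2.bounded
  exact tendsto_integral_abs_sub_of_isWeakFracDeriv hab hα h1.integrable h1.integrable_limit
    h2.integrable h2.integrable_limit
    (fun k => isWeakFracDeriv_weakFracDeriv s ((v k).mem_oneSidedSobolev s hs))
    (isWeakFracDeriv_weakFracDeriv s (w.mem_oneSidedSobolev s hs)) h1.tendsto h2.tendsto hB

end FracSpace

/-! ### Tangent planes, extended integrals and the energy -/

/-- The integrand is regular only for x in Ω. Extended by zero off S it becomes a Borel function,
and the composition changes only on a null set. -/
theorem aestronglyMeasurable_comp_of_continuousOn {X Y : Type*} [MeasurableSpace X]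
    {μ : Measure X} [TopologicalSpace Y] [MeasurableSpace Y] [OpensMeasurableSpace Y]
    {F : Y → ℝ} {S : Set Y} (hF : ContinuousOn F S) (hS : MeasurableSet S) {g : X → Y}
    (hg : AEMeasurable g μ) (hgS : ∀ᵐ x ∂μ, g x ∈ S) :
    AEStronglyMeasurable (fun x => F (g x)) μ := by
  classical
  have hm : Measurable (S.piecewise F fun _ => 0) := hF.measurable_piecewise continuousOn_const hS
  refine ((hm.comp_aemeasurable hg).congr ?_).aestronglyMeasurable
  filter_upwards [hgS] with x hx
  exact piecewise_eq_of_mem _ _ _ hx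

/-- The tangent plane of a convex function of two variables lies below its graph. -/
theorem tangent_le_of_convexOn {f : ℝ × ℝ → ℝ} (hf : ConvexOn ℝ univ f) {p q : ℝ}
    (hd : DifferentiableAt ℝ f (p, q)) (p' q' : ℝ) :
    f (p, q) + (deriv (fun t => f (t, q)) p * (p' - p) + deriv (fun t => f (p, t)) q * (q' - q)) ≤
      f (p', q') := by
  have e1 : deriv (fun t => f (t, q)) p = fderiv ℝ f (p, q) (1, 0) :=
    (hd.hasFDerivAt.comp_hasDerivAt p
      ((hasDerivAt_id p).prodMk (hasDerivAt_const p q))).deriv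
  have e2 : deriv (fun t => f (p, t)) q = fderiv ℝ f (p, q) (0, 1) :=
    (hd.hasFDerivAt.comp_hasDerivAt q
      ((hasDerivAt_const q p).prodMk (hasDerivAt_id q))).deriv
  set d : ℝ × ℝ := (p' - p, q' - q) with hd'
  have e3 : fderiv ℝ f (p, q) d =
      deriv (fun t => f (t, q)) p * (p' - p) + deriv (fun t => f (p, t)) q * (q' - q) := by
    have : d = (p' - p) • ((1 : ℝ), (0 : ℝ)) + (q' - q) • ((0 : ℝ), (1 : ℝ)) := by
      simp [hd']
    rw [this, map_add, map_smul, map_smul, e1, e2, smul_eq_mul, smul_eq_mul, mul_comm,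
      mul_comm (q' - q)]
  -- Restriction to the segment from (p, q) to (p', q'): for a convex function of one variable the
  -- derivative at 0 is at most the slope over [0, 1].
  have hl : HasDerivAt (fun t : ℝ => (p, q) + t • d) d 0 := by
    simpa using ((hasDerivAt_id (0 : ℝ)).smul_const d).const_add (p, q)
  have hfd : HasFDerivAt f (fderiv ℝ f (p, q)) ((p, q) + (0 : ℝ) • d) := by
    simpa using hd.hasFDerivAt
  have hder := hfd.comp_hasDerivAt (0 : ℝ) hl
  have hconv : ConvexOn ℝ univ (fun t : ℝ => f ((p, q) + t • d)) := by
    refine ⟨convex_univ, fun s _ t _ x y hx hy hxy => ?_⟩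
    have h := hf.2 (mem_univ ((p, q) + s • d)) (mem_univ ((p, q) + t • d)) hx hy hxy
    refine le_of_eq_of_le ?_ h
    obtain rfl : y = 1 - x := by linarith
    have e : (p, q) + (x • s + (1 - x) • t) • d =
        x • ((p, q) + s • d) + (1 - x) • ((p, q) + t • d) := by
      simp only [smul_eq_mul]
      module
    exact congrArg f e
  have h := hconv.le_slope_of_hasDerivAt (mem_univ 0) (mem_univ 1) one_pos hder
  rw [slope_def_field] at h
  have e4 : (p, q) + (1 : ℝ) • d = (p', q') := by simp [hd']
  simp only [e4, zero_smul, add_zero, sub_zero, div_one] at h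
  rw [e3] at h
  linarith

theorem extIntegral_congr {a b : ℝ} {f g : ℝ → ℝ} (h : ∀ x ∈ Ioo a b, f x = g x) :
    extIntegral a b f = extIntegral a b g := by
  have h1 : EqOn (fun x => ENNReal.ofReal (f x)) (fun x => ENNReal.ofReal (g x)) (Ioo a b) :=
    fun x hx => by simp only [h x hx]
  have h2 : EqOn (fun x => ENNReal.ofReal (-f x)) (fun x => ENNReal.ofReal (-g x)) (Ioo a b) :=
    fun x hx => by simp only [h x hx]
  rw [extIntegral, extIntegral, setLIntegral_congr_fun measurableSet_Ioo h1,
    setLIntegral_congr_fun measurableSet_Ioo h2]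

/-- Shifting by M makes the integrand nonnegative, at a finite cost because Ω has finite length.
Estimates in [0, ∞], including Fatou's lemma, then apply to the energy. -/
theorem extIntegral_eq_sub {a b : ℝ} {f : ℝ → ℝ}
    (hf : AEStronglyMeasurable f (volume.restrict (Ioo a b))) {M : ℝ} (hM : 0 ≤ M)
    (h : ∀ x ∈ Ioo a b, -M ≤ f x) :
    extIntegral a b f = ((∫⁻ x in Ioo a b, ENNReal.ofReal (f x + M) : ℝ≥0∞) : EReal) -
      ((M * (volume.restrict (Ioo a b)).real univ : ℝ) : EReal) := by
  -- The identity f⁺ + M = (f + M) + f⁻ is kept additive, so that no infinite quantity is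
  -- subtracted.
  have hpt : ∀ x ∈ Ioo a b, ENNReal.ofReal (f x) + ENNReal.ofReal M =
      ENNReal.ofReal (f x + M) + ENNReal.ofReal (-f x) := by
    intro x hx
    have h1 := h x hx
    rcases le_total 0 (f x) with h2 | h2
    · rw [ENNReal.ofReal_of_nonpos (by linarith : -f x ≤ 0), add_zero, ENNReal.ofReal_add h2 hM]
    · rw [ENNReal.ofReal_of_nonpos h2, zero_add,
        ← ENNReal.ofReal_add (by linarith) (by linarith)]
      congr 1; ring
  have hint := setLIntegral_congr_fun measurableSet_Ioo hpt (μ := volume)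
  rw [lintegral_add_left' hf.aemeasurable.ennreal_ofReal,
    lintegral_add_left' (hf.aemeasurable.add_const M).ennreal_ofReal, lintegral_const] at hint
  have hm : ENNReal.ofReal M * (volume.restrict (Ioo a b)) univ =
      ENNReal.ofReal (M * (volume.restrict (Ioo a b)).real univ) := by
    rw [ENNReal.ofReal_mul hM, ofReal_measureReal]
  rw [hm] at hint
  have hneg : ∫⁻ x in Ioo a b, ENNReal.ofReal (-f x) ≠ ⊤ := by
    refine ne_top_of_le_ne_top (ENNReal.ofReal_ne_top
      (r := M * (volume.restrict (Ioo a b)).real univ)) ?_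
    rw [← hm, ← lintegral_const]
    refine lintegral_mono_ae ((ae_restrict_iff' measurableSet_Ioo).2 (ae_of_all _ fun x hx => ?_))
    exact ENNReal.ofReal_le_ofReal (by linarith [h x hx])
  rw [extIntegral]
  have hm0 : 0 ≤ M * (volume.restrict (Ioo a b)).real univ := mul_nonneg hM measureReal_nonneg
  generalize M * (volume.restrict (Ioo a b)).real univ = m at *
  generalize (∫⁻ x in Ioo a b, ENNReal.ofReal (f x)) = A at *
  generalize (∫⁻ x in Ioo a b, ENNReal.ofReal (f x + M)) = B at *
  generalize (∫⁻ x in Ioo a b, ENNReal.ofReal (-f x)) = N at *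
  lift N to NNReal using hneg
  -- The integrals of f⁺ and f + M are infinite together, as those of f⁻ and M are finite.
  induction A using ENNReal.recTopCoe with
  | top =>
    rw [top_add, eq_comm, ENNReal.add_eq_top] at hint
    simp only [ENNReal.coe_ne_top, or_false] at hint
    subst hint
    simp only [EReal.coe_ennreal_top]
    rw [EReal.top_sub_coe, show ((N : ℝ≥0∞) : EReal) = ((N : ℝ) : EReal) from rfl,
      EReal.top_sub_coe]
  | coe A =>
    have hB : B ≠ ⊤ := by
      rintro rfl
      rw [top_add] at hint
      exact (ENNReal.add_ne_top.2 ⟨ENNReal.coe_ne_top, ENNReal.ofReal_ne_top⟩) hint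
    lift B to NNReal using hB
    have h2 := congrArg ENNReal.toReal hint
    rw [ENNReal.toReal_add ENNReal.coe_ne_top ENNReal.ofReal_ne_top,
      ENNReal.toReal_add ENNReal.coe_ne_top ENNReal.coe_ne_top, ENNReal.toReal_ofReal hm0] at h2
    simp only [ENNReal.coe_toReal] at h2
    have e : ∀ N : NNReal, ((N : ℝ≥0∞) : EReal) = ((N : ℝ) : EReal) := fun _ => rfl
    rw [e, e, e, ← EReal.coe_sub, ← EReal.coe_sub]
    congr 1
    linarith

/-- Lower semicontinuity of the energy along weakly convergent sequences of derivatives and almost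
everywhere convergent sequences of functions. -/
theorem extIntegral_le_of_isWeakL1Limit {a b : ℝ} {L : ℝ → ℝ → ℝ → ℝ → ℝ}
    (hL : DifferentiableOn ℝ (fun z : ℝ × ℝ × ℝ × ℝ => L z.1 z.2.1 z.2.2.1 z.2.2.2)
      {z | z.2.2.2 ∈ Ioo a b})
    {C : ℝ} (hbdd : ∀ a₁ a₂ a₃, ∀ x ∈ Ioo a b, C ≤ L a₁ a₂ a₃ x)
    (hconv : ∀ a₃, ∀ x ∈ Ioo a b, ConvexOn ℝ univ (fun z : ℝ × ℝ => L z.1 z.2 a₃ x))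
    {L₁ L₂ : ℝ → ℝ → ℝ → ℝ}
    (hL₁ : ContinuousOn (fun z : ℝ × ℝ × ℝ => L₁ z.1 z.2.1 z.2.2) {z | z.2.2 ∈ Ioo a b})
    (hL₂ : ContinuousOn (fun z : ℝ × ℝ × ℝ => L₂ z.1 z.2.1 z.2.2) {z | z.2.2 ∈ Ioo a b})
    (hstruct₁ : ∀ a₁ a₂ a₃, ∀ x ∈ Ioo a b, deriv (fun t => L t a₂ a₃ x) a₁ = L₁ a₁ a₃ x)
    (hstruct₂ : ∀ a₁ a₂ a₃, ∀ x ∈ Ioo a b, deriv (fun t => L a₁ t a₃ x) a₂ = L₂ a₂ a₃ x)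
    {P Q U : ℕ → ℝ → ℝ} {p q u : ℝ → ℝ}
    (hP : IsWeakL1Limit (volume.restrict (Ioo a b)) P p)
    (hQ : IsWeakL1Limit (volume.restrict (Ioo a b)) Q q)
    (hU : ∀ k, AEMeasurable (U k) (volume.restrict (Ioo a b)))
    (hu : AEMeasurable u (volume.restrict (Ioo a b)))
    (hUu : ∀ᵐ x ∂(volume.restrict (Ioo a b)), Tendsto (fun k => U k x) atTop (𝓝 (u x)))
    {c : EReal} (hc : ∀ k, extIntegral a b (fun x => L (P k x) (Q k x) (U k x) x) ≤ c) :
    extIntegral a b (fun x => L (p x) (q x) (u x) x) ≤ c := by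
  set μ := volume.restrict (Ioo a b) with hμ
  have hmem : ∀ᵐ x ∂μ, x ∈ Ioo a b := ae_restrict_mem measurableSet_Ioo
  have hO4 : IsOpen {z : ℝ × ℝ × ℝ × ℝ | z.2.2.2 ∈ Ioo a b} :=
    isOpen_Ioo.preimage (by fun_prop)
  have hO3 : IsOpen {z : ℝ × ℝ × ℝ | z.2.2 ∈ Ioo a b} := isOpen_Ioo.preimage (by fun_prop)
  have hp := hP.integrable_limit.aemeasurable
  have hq := hQ.integrable_limit.aemeasurable
  have hLm : ∀ {p q u : ℝ → ℝ}, AEMeasurable p μ → AEMeasurable q μ → AEMeasurable u μ →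
      AEStronglyMeasurable (fun x => L (p x) (q x) (u x) x) μ := fun hp hq hu =>
    aestronglyMeasurable_comp_of_continuousOn hL.continuousOn hO4.measurableSet
      (hp.prodMk (hq.prodMk (hu.prodMk aemeasurable_id))) hmem
  have hm3 : ∀ {L₁ : ℝ → ℝ → ℝ → ℝ},
      ContinuousOn (fun z : ℝ × ℝ × ℝ => L₁ z.1 z.2.1 z.2.2) {z | z.2.2 ∈ Ioo a b} →
      ∀ {p u : ℝ → ℝ}, AEMeasurable p μ → AEMeasurable u μ →
      AEStronglyMeasurable (fun x => L₁ (p x) (u x) x) μ := fun hL₁ _ _ hp hu =>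
    aestronglyMeasurable_comp_of_continuousOn hL₁ hO3.measurableSet
      (hp.prodMk (hu.prodMk aemeasurable_id)) hmem
  have hlim3 : ∀ {L₁ : ℝ → ℝ → ℝ → ℝ},
      ContinuousOn (fun z : ℝ × ℝ × ℝ => L₁ z.1 z.2.1 z.2.2) {z | z.2.2 ∈ Ioo a b} →
      ∀ p : ℝ → ℝ, ∀ᵐ x ∂μ,
        Tendsto (fun k => L₁ (p x) (U k x) x) atTop (𝓝 (L₁ (p x) (u x) x)) := by
    intro L₁ hL₁ p
    filter_upwards [hmem, hUu] with x hx h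
    exact ((hL₁.continuousAt (hO3.mem_nhds (x := (p x, u x, x)) hx)).tendsto).comp
      (tendsto_const_nhds.prodMk_nhds (h.prodMk_nhds tendsto_const_nhds))
  -- The lower bound C may be positive, whereas the shift has to be nonnegative.
  set M := max (-C) 0 with hM
  have hM0 : 0 ≤ M := le_max_right _ _
  have hLM : ∀ a₁ a₂ a₃, ∀ x ∈ Ioo a b, -M ≤ L a₁ a₂ a₃ x := fun a₁ a₂ a₃ x hx => by
    have := hbdd a₁ a₂ a₃ x hx
    have := le_max_left (-C) 0
    linarith
  set m : EReal := ((M * μ.real univ : ℝ) : EReal) with hm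
  have hE : ∀ {p q u : ℝ → ℝ}, AEMeasurable p μ → AEMeasurable q μ → AEMeasurable u μ →
      extIntegral a b (fun x => L (p x) (q x) (u x) x) =
        ((∫⁻ x, ENNReal.ofReal (L (p x) (q x) (u x) x + M) ∂μ : ℝ≥0∞) : EReal) - m :=
    fun hp hq hu => extIntegral_eq_sub (hLm hp hq hu) hM0 fun x hx => hLM _ _ _ x hx
  have hle : ∀ A : EReal, A - m ≤ c ↔ A ≤ c + m := fun A =>
    EReal.sub_le_iff_le_add (Or.inl (EReal.coe_ne_bot _)) (Or.inl (EReal.coe_ne_top _))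
  have hck : ∀ k, ((∫⁻ x, ENNReal.ofReal (L (P k x) (Q k x) (U k x) x + M) ∂μ : ℝ≥0∞) : EReal) ≤
      c + m := fun k => by
    rw [← hle, ← hE (hP.integrable k).aemeasurable (hQ.integrable k).aemeasurable (hU k)]
    exact hc k
  -- This moves the comparison from the extended reals into [0, ∞].
  have hcm : 0 ≤ c + m := (EReal.coe_ennreal_nonneg _).trans (hck 0)
  rw [hE hp hq hu, hle, ← EReal.coe_toENNReal hcm, EReal.coe_ennreal_le_coe_ennreal_iff]
  obtain ⟨B, hB⟩ := hP.bounded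
  obtain ⟨B', hB'⟩ := hQ.bounded
  -- The tangent plane is taken at the limit derivatives (p x, q x) but at the value U k x. Its
  -- constant term and slopes thus contain the almost everywhere convergent U k and never P k or Q
  -- k, which converge only weakly.
  refine lintegral_le_of_forall_affine_le
    (G₀ := fun k x => L (p x) (q x) (U k x) x + M) (G₁ := fun k x => L₁ (p x) (U k x) x)
    (G₂ := fun k x => L₂ (q x) (U k x) x) (F₁ := fun x => L₁ (p x) (u x) x)
    (F₂ := fun x => L₂ (q x) (u x) x) (P := P) (Q := Q) (p := p) (q := q)
    (W := fun k x => L (P k x) (Q k x) (U k x) x + M)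
    (fun k => (hLm hp hq (hU k)).add_const M) (fun k => hm3 hL₁ hp (hU k))
    (fun k => hm3 hL₂ hq (hU k)) ((hLm hp hq hu).add_const M) (hm3 hL₁ hp hu) (hm3 hL₂ hq hu)
    ?_ (hlim3 hL₁ p) (hlim3 hL₂ q) hP.integrable hP.integrable_limit hP.tendsto
    hQ.integrable hQ.integrable_limit hQ.tendsto hB hB' ?_ (fun k => ?_) fun k => ?_
  · filter_upwards [hmem, hUu] with x hx h
    exact (((hL.continuousOn.continuousAt (hO4.mem_nhds (x := (p x, q x, u x, x)) hx)).tendsto).comp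
      (tendsto_const_nhds.prodMk_nhds (tendsto_const_nhds.prodMk_nhds
        (h.prodMk_nhds tendsto_const_nhds)))).add_const M
  · filter_upwards [hmem] with x hx
    have := hLM (p x) (q x) (u x) x hx
    simp only [Pi.zero_apply]
    linarith
  · filter_upwards [hmem] with x hx
    have hd : DifferentiableAt ℝ (fun z : ℝ × ℝ => L z.1 z.2 (U k x) x) (p x, q x) := by
      have h1 := hL.differentiableAt (hO4.mem_nhds (x := (p x, q x, U k x, x)) hx)
      exact h1.comp (p x, q x) (f := fun z : ℝ × ℝ => (z.1, z.2, U k x, x)) (by fun_prop)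
    have h := tangent_le_of_convexOn (hconv (U k x) x hx) hd (P k x) (Q k x)
    simp only [hstruct₁ _ _ _ x hx, hstruct₂ _ _ _ x hx] at h
    linarith
  · have h := EReal.toENNReal_le_toENNReal (hck k)
    rwa [EReal.toENNReal_coe] at h

/-! ### Weak lower semicontinuity of the energy -/

theorem weaklyLSC_energy {a b : ℝ} (hab : a < b) {α : ℝ} (hα : α ∈ Ioo (0 : ℝ) 1)
    (p : ℝ≥0∞) [Fact (1 ≤ p)] (θ lam : ℝ)
    (L : ℝ → ℝ → ℝ → ℝ → ℝ)
    (hform : ∃ L₀ : ℝ → ℝ → ℝ → ℝ → ℝ, ∀ a₁ a₂ a₃, ∀ x ∈ Ioo a b,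
      L a₁ a₂ a₃ x = L₀ ((1 - θ) * a₁) (θ * a₂) a₃ x)
    (hsmooth : ContDiffOn ℝ ∞ (fun z : ℝ × ℝ × ℝ × ℝ => L z.1 z.2.1 z.2.2.1 z.2.2.2)
      {z | z.2.2.2 ∈ Ioo a b})
    (hbdd : ∃ C : ℝ, ∀ a₁ a₂ a₃, ∀ x ∈ Ioo a b, C ≤ L a₁ a₂ a₃ x)
    (hconv : ∀ a₃, ∀ x ∈ Ioo a b, ConvexOn ℝ univ (fun z : ℝ × ℝ => L z.1 z.2 a₃ x))
    (L₁ L₂ : ℝ → ℝ → ℝ → ℝ)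
    (hL₁ : ContDiffOn ℝ ∞ (fun z : ℝ × ℝ × ℝ => L₁ z.1 z.2.1 z.2.2) {z | z.2.2 ∈ Ioo a b})
    (hL₂ : ContDiffOn ℝ ∞ (fun z : ℝ × ℝ × ℝ => L₂ z.1 z.2.1 z.2.2) {z | z.2.2 ∈ Ioo a b})
    (hstruct₁ : ∀ a₁ a₂ a₃, ∀ x ∈ Ioo a b, deriv (fun t => L t a₂ a₃ x) a₁ = L₁ a₁ a₃ x)
    (hstruct₂ : ∀ a₁ a₂ a₃, ∀ x ∈ Ioo a b, deriv (fun t => L a₁ t a₃ x) a₂ = L₂ a₂ a₃ x) :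
    WeaklyLSC (fun v : FracSpace hab hα p θ lam => energy α L v.toLpI) := by
  intro v w hvw
  -- For every θ at least one side has its derivative under control, and one suffices for strong L¹
  -- convergence.
  obtain ⟨s, hs⟩ : ∃ s : Side, s = .left ∧ θ ≠ 1 ∨ s = .right ∧ θ ≠ 0 := by
    by_cases h1 : θ = 1
    · exact ⟨.right, Or.inr ⟨rfl, by simp [h1]⟩⟩
    · exact ⟨.left, Or.inl ⟨rfl, h1⟩⟩
  obtain ⟨L₀, hL₀⟩ := hform
  obtain ⟨C, hC⟩ := hbdd
  have hu := FracSpace.isWeakL1Limit_toLpI s hs hvw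
  -- the derivatives on which the integrand depends
  obtain ⟨P, p', hP, hPe⟩ : ∃ P p', IsWeakL1Limit (volume.restrict (Ioo a b)) P p' ∧
      ∀ a₂ a₃, ∀ x ∈ Ioo a b, (∀ k, L (weakFracDeriv a b α .left (v k).toLpI x) a₂ a₃ x =
        L (P k x) a₂ a₃ x) ∧ L (weakFracDeriv a b α .left w.toLpI x) a₂ a₃ x =
        L (p' x) a₂ a₃ x := by
    -- For θ = 1 the first argument enters only through (1 - θ) a₁ = 0, so the left derivative,
    -- which need not exist, may be replaced by zero.
    by_cases h1 : θ = 1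
    · exact ⟨_, _, IsWeakL1Limit.zero _, fun a₂ a₃ x hx =>
        ⟨fun k => by simp [hL₀ _ _ _ x hx, h1], by simp [hL₀ _ _ _ x hx, h1]⟩⟩
    · exact ⟨_, _, FracSpace.isWeakL1Limit_weakFracDeriv .left (Or.inl ⟨rfl, h1⟩) hvw,
        fun _ _ _ _ => ⟨fun _ => rfl, rfl⟩⟩
  obtain ⟨Q, q, hQ, hQe⟩ : ∃ Q q, IsWeakL1Limit (volume.restrict (Ioo a b)) Q q ∧
      ∀ a₁ a₃, ∀ x ∈ Ioo a b, (∀ k, L a₁ (weakFracDeriv a b α .right (v k).toLpI x) a₃ x =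
        L a₁ (Q k x) a₃ x) ∧ L a₁ (weakFracDeriv a b α .right w.toLpI x) a₃ x =
        L a₁ (q x) a₃ x := by
    by_cases h0 : θ = 0
    · exact ⟨_, _, IsWeakL1Limit.zero _, fun a₁ a₃ x hx =>
        ⟨fun k => by simp [hL₀ _ _ _ x hx, h0], by simp [hL₀ _ _ _ x hx, h0]⟩⟩
    · exact ⟨_, _, FracSpace.isWeakL1Limit_weakFracDeriv .right (Or.inr ⟨rfl, h0⟩) hvw,
        fun _ _ _ _ => ⟨fun _ => rfl, rfl⟩⟩
  -- For any c above the liminf, infinitely many energies lie below c. A further subsequence of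
  -- these converges almost everywhere, and the bound c passes to the limit.
  refine le_of_forall_gt_imp_ge_of_dense fun c hc => ?_
  obtain ⟨n, hn, hnc⟩ := extraction_of_frequently_atTop
    (frequently_lt_of_liminf_lt (by isBoundedDefault) hc)
  have hlim := (FracSpace.tendsto_integral_abs_sub s hs hvw).comp hn.tendsto_atTop
  obtain ⟨n', hn', hae⟩ := exists_strictMono_tendsto_ae (fun k => hu.integrable (n k))
    hu.integrable_limit hlim
  have hnn : Tendsto (fun k => n (n' k)) atTop atTop := (hn.comp hn').tendsto_atTop
  have hw : energy α L w.toLpI = extIntegral a b fun x => L (p' x) (q x) (w.toLpI x) x :=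
    extIntegral_congr fun x hx => by rw [(hPe _ _ x hx).2, (hQe _ _ x hx).2]
  have hv : ∀ k, energy α L (v k).toLpI =
      extIntegral a b fun x => L (P k x) (Q k x) ((v k).toLpI x) x := fun k =>
    extIntegral_congr fun x hx => by rw [(hPe _ _ x hx).1, (hQe _ _ x hx).1]
  refine hw.trans_le ?_
  refine extIntegral_le_of_isWeakL1Limit (hsmooth.differentiableOn (by simp)) hC hconv
    hL₁.continuousOn hL₂.continuousOn hstruct₁ hstruct₂ (hP.comp hnn) (hQ.comp hnn)
    (fun k => (hu.integrable (n (n' k))).aemeasurable) hu.integrable_limit.aemeasurable hae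
    fun k => ?_
  rw [← hv]
  exact (hnc (n' k)).le

end FracCalc

end

theorem mainTheorem2 {a b : ℝ} (hab : a < b) {α : ℝ} (hα : α ∈ Ioo (0 : ℝ) 1)
    (p : ℝ≥0∞) [Fact (1 ≤ p)] (hp1 : 1 < p) (hp : p < ⊤)
    (θ lam : ℝ) (hθ : θ ∈ Icc (0 : ℝ) 1) (hlam : lam = 0 ∨ lam = 1)
    (L : ℝ → ℝ → ℝ → ℝ → ℝ)
    (hform : ∃ L₀ : ℝ → ℝ → ℝ → ℝ → ℝ, ∀ a₁ a₂ a₃, ∀ x ∈ Ioo a b,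
      L a₁ a₂ a₃ x = L₀ ((1 - θ) * a₁) (θ * a₂) a₃ x)
    (hsmooth : ContDiffOn ℝ ∞ (fun z : ℝ × ℝ × ℝ × ℝ => L z.1 z.2.1 z.2.2.1 z.2.2.2)
      {z | z.2.2.2 ∈ Ioo a b})
    (hbdd : ∃ C : ℝ, ∀ a₁ a₂ a₃, ∀ x ∈ Ioo a b, C ≤ L a₁ a₂ a₃ x)
    (hconv : ∀ a₃, ∀ x ∈ Ioo a b, ConvexOn ℝ univ (fun z : ℝ × ℝ => L z.1 z.2 a₃ x))
    (L₁ L₂ : ℝ → ℝ → ℝ → ℝ)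
    (hL₁ : ContDiffOn ℝ ∞ (fun z : ℝ × ℝ × ℝ => L₁ z.1 z.2.1 z.2.2) {z | z.2.2 ∈ Ioo a b})
    (hL₂ : ContDiffOn ℝ ∞ (fun z : ℝ × ℝ × ℝ => L₂ z.1 z.2.1 z.2.2) {z | z.2.2 ∈ Ioo a b})
    (hstruct₁ : ∀ a₁ a₂ a₃, ∀ x ∈ Ioo a b, deriv (fun t => L t a₂ a₃ x) a₁ = L₁ a₁ a₃ x)
    (hstruct₂ : ∀ a₁ a₂ a₃, ∀ x ∈ Ioo a b, deriv (fun t => L a₁ t a₃ x) a₂ = L₂ a₂ a₃ x) :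
    FracCalc.WeaklyLSC
      (fun v : FracCalc.FracSpace hab hα p θ lam => FracCalc.energy α L v.toLpI) := by
  exact FracCalc.weaklyLSC_energy hab hα p θ lam L hform hsmooth hbdd hconv L₁ L₂ hL₁ hL₂ hstruct₁
    hstruct₂
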